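/- Let $(\Omega,\mathcal F,P)$ be a probability space. **Model.** Let $y_t=\mu_t+e_t$, $t\ge 1$, with $\mu_t=\sum_{j\ge1}\theta_j x_{tj}$, where $\sum_j|\theta_j|<\infty$, $\sup_{t,j\ge1}E(x_{tj}^2)<\infty$, and $\{e_t\}$ is independent of $\{x_{tj}\}$. Write $Y_n=(y_1,\dots,y_n)'$, $\mu_n=(\mu_1,\dots,\mu_n)'$, $\mathbf e_n=(e_1,\dots,e_n)'$ and $\Sigma_n=E(\mathbf e_n\mathbf e_n')$. **Errors (Assumptions 1 and 2).** $\{e_t\}_{t\in\mathbb Z}$ is a stationary, mean-zero, finite-variance process with autocovariances satisfying $\sum_{j\in\mathbb Z}\gamma_j^2<\infty$, and $e_t=\sum_{k\ge0}\beta_k\alpha_{t-k}$ with $\beta_0=1$, where $\alpha_t$ is $\mathcal F_t$-measurable for an increasing family of $\sigma$-fields $(\mathcal F_t)_{t\in\mathbb Z}$. Almost surely $E(\alpha_t|\mathcal F_{t-1})=0$ and $E(\alpha_t^2|\mathcal F_{t-1})=\sigma_\alpha^2$ for all $t$, and, for a fixed integer $N\ge1$, some $S>4N$ and some $0<C_S<\infty$,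 $\sup_{t}E(|\alpha_t|^S|\mathcal F_{t-1})\le C_S$. Moreover $\sum_j|\beta_j|<\infty$, and the spectral density $f_e(\lambda)=\frac{\sigma_\alpha^2}{2\pi}\bigl|\sum_{j\ge0}\beta_je^{-ij\lambda}\bigr|^2$ is nonzero for all $-\pi<\lambda\le\pi$. **Candidate models.** For each $n$ there are $M=M_n$ models (with $M_n\ge1$ for all large $n$), and model $m$ uses the first $k_m=k_{n,m}$ regressors, $1\le k_1<\dots<k_M<n$. Let $X_m=(x_{ij})_{1\le i\le n,\,1\le j\le k_m}$ and assume that $X_M$ has full rank almost surely. Put $P^*_m=X_m(X_m'\Sigma_n^{-1}X_m)^{-1}X_m'\Sigma_n^{-1}$, $P_m=\Sigma_n^{-1/2}X_m(X_m'\Sigma_n^{-1}X_m)^{-1}X_m'\Sigma_n^{-1/2}$, $\hat\mu_n(w)=\sum_{m=1}^Mw_mP^*_mY_n$ for $w\in\mathbb R^M$, and $$L^*_n(w)=(\hat\mu_n(w)-\mu_n)'\Sigma_n^{-1}(\hat\mu_n(w)-\mu_n),$$ $$C^*_n(w)=(Y_n-\hat\mu_n(w))'\Sigma_n^{-1}(Y_n-\hat\mu_n(w))+2\sum_{m=1}^Mw_mk_m,$$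 $$D_n(m)=\mu_n'\Sigma_n^{-1/2}(I-P_m)\Sigma_n^{-1/2}\mu_n+k_m,\qquad k^*_n=\min_{1\le m\le M}D_n(m).$$ **Weights.** Fix $0<\underline\delta<1/N$ and let $\mathcal H_N$ be the set of all $w\in\mathbb R^M$ with $\sum_mw_m=1$ that have at least one and at most $N$ nonzero components, each of which lies in $[\underline\delta,1]$. **Theorem.** Suppose that $k^*_n\to\infty$ almost surely. If $\tilde w_n\in\mathcal H_N$ minimizes $C^*_n$ over $\mathcal H_N$, then $$\frac{L^*_n(\tilde w_n)}{\inf_{w\in\mathcal H_N}L^*_n(w)}\longrightarrow1\quad\text{in probability as }n\to\infty.$$ -/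

import Mathlib

open MeasureTheory ProbabilityTheory Filter Topology
open scoped Matrix MatrixOrder

namespace AMMA

/-! ### The error process -/

/-- Conditions on the errors `e t`, `t ∈ ℤ`: a zero mean, (wide sense) stationary process with square
summable autocovariances, which is a one-sided linear process `e t = ∑ k ≥ 0, β k * α (t - k)` with
`β 0 = 1`, driven by martingale differences `α t` with respect to the filtration `ℱ`, with constant
conditional variance `σ ^ 2` and with conditional `S`-th absolute moments bounded by a constant. -/
structure IsLinearErrorProcess {Ω : Type*} [mΩ : MeasurableSpace Ω] (P : Measure Ω)
    (e : ℤ → Ω → ℝ) (ℱ : Filtration ℤ mΩ) (α : ℤ → Ω → ℝ) (β : ℕ → ℝ) (σ S : ℝ) : Prop where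
  measurable : ∀ t, Measurable (e t)
  memLp : ∀ t, MemLp (e t) 2 P
  mean_zero : ∀ t, ∫ ω, e t ω ∂P = 0
  stationary : ∀ s t j : ℤ, ∫ ω, e s ω * e (s + j) ω ∂P = ∫ ω, e t ω * e (t + j) ω ∂P
  acf_sq_summable : Summable fun j : ℤ => (∫ ω, e 0 ω * e j ω ∂P) ^ 2
  beta_zero : β 0 = 1
  linear : ∀ t, ∀ᵐ ω ∂P, HasSum (fun k : ℕ => β k * α (t - k) ω) (e t ω)
  adapted : ∀ t, Measurable[ℱ t] (α t)
  condMean : ∀ t, P[α t | ℱ (t - 1)] =ᵐ[P] fun _ => 0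
  condVar : ∀ t, P[fun ω => (α t ω) ^ 2 | ℱ (t - 1)] =ᵐ[P] fun _ => σ ^ 2
  integrable_moment : ∀ t, Integrable (fun ω => |α t ω| ^ S) P
  condMoment : ∃ C : ℝ, 0 < C ∧ ∀ t, P[fun ω => |α t ω| ^ S | ℱ (t - 1)] ≤ᵐ[P] fun _ => C

/-- The spectral density `(σ² / 2π) |∑ j ≥ 0, β j exp (-i j l)|²` of the linear process. -/
noncomputable def spectralDensity (β : ℕ → ℝ) (σ l : ℝ) : ℝ :=
  σ ^ 2 / (2 * Real.pi) *
    ‖∑' j : ℕ, (β j : ℂ) * Complex.exp (-(Complex.I * (j : ℂ) * (l : ℂ)))‖ ^ 2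

/-- The coefficients are absolutely summable and the spectral density has no zero. -/
structure HasNonvanishingSpectrum (β : ℕ → ℝ) (σ : ℝ) : Prop where
  summable : Summable fun j => |β j|
  ne_zero : ∀ l : ℝ, -Real.pi < l → l ≤ Real.pi → spectralDensity β σ l ≠ 0

/-- `Σ_n = E (e_n e_n')`, where `e_n = (e_1, …, e_n)'`; the index `i : Fin n` is the time `i + 1`. -/
noncomputable def errCov {Ω : Type*} [MeasurableSpace Ω] (P : Measure Ω) (e : ℤ → Ω → ℝ) (n : ℕ) :
    Matrix (Fin n) (Fin n) ℝ :=
  Matrix.of fun i j => ∫ ω, e ((i : ℕ) + 1) ω * e ((j : ℕ) + 1) ω ∂P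

/-! ### Regression model, for given values of the regressors and the errors

The array `x : ℕ → ℕ → ℝ` is zero-based: `x i j` is the regressor `j + 1` at time `i + 1`. -/

/-- `μ_n = (μ_1, …, μ_n)'` with `μ_t = ∑ j, θ_j x_{tj}`. -/
noncomputable def regMean (θ : ℕ → ℝ) (x : ℕ → ℕ → ℝ) (n : ℕ) : Fin n → ℝ :=
  fun i => ∑' j : ℕ, θ j * x i j

/-- `Y_n = μ_n + e_n`. -/
noncomputable def response (θ : ℕ → ℝ) (x : ℕ → ℕ → ℝ) (e : ℤ → ℝ) (n : ℕ) : Fin n → ℝ :=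
  fun i => regMean θ x n i + e ((i : ℕ) + 1)

/-- The `n × K` design matrix of the first `K` regressors. -/
def design (x : ℕ → ℕ → ℝ) (n K : ℕ) : Matrix (Fin n) (Fin K) ℝ :=
  Matrix.of fun i j => x i j

/-- The GLS hat matrix `X (X' Σ⁻¹ X)⁻¹ X' Σ⁻¹`. -/
noncomputable def glsHat {n K : ℕ} (V : Matrix (Fin n) (Fin n) ℝ) (X : Matrix (Fin n) (Fin K) ℝ) :
    Matrix (Fin n) (Fin n) ℝ :=
  X * (Xᵀ * V⁻¹ * X)⁻¹ * Xᵀ * V⁻¹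

/-- `Σ^{-1/2}`, the positive semidefinite square root of `Σ⁻¹`. -/
noncomputable def invSqrt {n : ℕ} (V : Matrix (Fin n) (Fin n) ℝ) : Matrix (Fin n) (Fin n) ℝ :=
  CFC.sqrt V⁻¹

/-- `Σ^{-1/2} X (X' Σ⁻¹ X)⁻¹ X' Σ^{-1/2}`, the orthogonal projection onto the column space of
`Σ^{-1/2} X`. -/
noncomputable def proj {n K : ℕ} (V : Matrix (Fin n) (Fin n) ℝ) (X : Matrix (Fin n) (Fin K) ℝ) :
    Matrix (Fin n) (Fin n) ℝ :=
  invSqrt V * X * (Xᵀ * V⁻¹ * X)⁻¹ * Xᵀ * invSqrt V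

/-- The averaging estimator `∑ m, w_m P*_m Y`; model `m` uses the first `k m` regressors. -/
noncomputable def avgEstimator {n M : ℕ} (V : Matrix (Fin n) (Fin n) ℝ) (x : ℕ → ℕ → ℝ)
    (k : Fin M → ℕ) (Y : Fin n → ℝ) (w : Fin M → ℝ) : Fin n → ℝ :=
  (∑ m, w m • glsHat V (design x n (k m))) *ᵥ Y

/-- The generalized squared error loss `L*_n(w)`. -/
noncomputable def loss {n M : ℕ} (V : Matrix (Fin n) (Fin n) ℝ) (x : ℕ → ℕ → ℝ)
    (k : Fin M → ℕ) (μ Y : Fin n → ℝ) (w : Fin M → ℝ) : ℝ :=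
  (avgEstimator V x k Y w - μ) ⬝ᵥ (V⁻¹ *ᵥ (avgEstimator V x k Y w - μ))

/-- The AMMA criterion `C*_n(w)`. -/
noncomputable def criterion {n M : ℕ} (V : Matrix (Fin n) (Fin n) ℝ) (x : ℕ → ℕ → ℝ)
    (k : Fin M → ℕ) (Y : Fin n → ℝ) (w : Fin M → ℝ) : ℝ :=
  (Y - avgEstimator V x k Y w) ⬝ᵥ (V⁻¹ *ᵥ (Y - avgEstimator V x k Y w)) +
    2 * ∑ m, w m * (k m : ℝ)

/-- `D_n(m) = μ' Σ^{-1/2} (I - P_m) Σ^{-1/2} μ + k_m`, for a model with `K = k_m` regressors. -/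
noncomputable def modelRisk {n : ℕ} (V : Matrix (Fin n) (Fin n) ℝ) (x : ℕ → ℕ → ℝ)
    (μ : Fin n → ℝ) (K : ℕ) : ℝ :=
  μ ⬝ᵥ ((invSqrt V * (1 - proj V (design x n K)) * invSqrt V) *ᵥ μ) + (K : ℝ)

/-! ### Weights -/

/-- Weight vectors with exactly `l` nonzero components, each in `[δ, 1]`, with sum `1`. -/
def weightSetExact (M l : ℕ) (δ : ℝ) : Set (Fin M → ℝ) :=
  {w | (∀ i, w i ≠ 0 → δ ≤ w i ∧ w i ≤ 1) ∧ {i | w i ≠ 0}.ncard = l ∧ ∑ i, w i = 1}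

/-- The continuous sparse weight set `H_N`. -/
def weightSet (M N : ℕ) (δ : ℝ) : Set (Fin M → ℝ) :=
  ⋃ l ∈ Finset.Icc 1 N, weightSetExact M l δ

end AMMA

/-! In the inner product of `Σ⁻¹` the GLS hat matrices form an increasing chain of orthogonal
projections, so a product of two of them is the smaller one. Write `b_m` for the squared bias of
model `m`, `q_m` for the energy of the projected errors and `a_m` for the bias-error cross term.
Then the loss is a double average over pairs of active models of `b` at the larger, `q` at the
smaller and a difference of two `a`'s. The criterion has the same shape, and criterion minus loss
minus the total noise energy is linear in the weights: `2 ∑ w_m (a_m - (q_m - k_m))`.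

Let `D_m = b_m + k_m`, and let `R(w)` be the pair average of `b_max + k_min`. Every active weight is
at least `δ`, so the diagonal terms give `δ² D_m ≤ R(w)` for each active `m`. If `|a_m|` and `|q_m -
k_m|` are at most `η D_m` for all `m`, then loss, risk and centred criterion agree up to a relative
error of order `η / δ²`, uniformly in `w`, and a minimizer of the criterion nearly minimizes the
loss (`abs_loss_ratio_sub_one_le`).

It remains to control all models at once with probability tending to one. A quadratic form in
homoscedastic martingale differences has variance bounded by the squared Frobenius norm of its
matrix (`integral_quadratic_sq_le`); truncation and Fatou carry this to the errors. Hence, for fixed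
regressors, `E a_m⁴ ≤ C b_m²` and `E (q_m - k_m)² ≤ C k_m`. For the cross terms a union bound costs
`∑ D_m⁻²`, which is small because the `k_m` are distinct and `min D_m → ∞`. For the noise terms it
would cost `∑ k_m / D_m²`, possibly a harmonic sum. Since both `q_m` and `k_m` increase in `m`, it
is enough to control the first and last model of each block of dimensions between consecutive
squares: these cost `∑ j² / j⁴`, and the block length `2 j` is negligible against `D_m`.
Independence and Fubini remove the conditioning on the regressors, and Markov's inequality
concludes. -/

namespace AMMA

/-! ### Moments of linear and quadratic forms in martingale differences -/

/-- Martingale differences with constant conditional variance and bounded fourth moments. -/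
structure IsHomoscedasticMDS {Ω : Type*} [mΩ : MeasurableSpace Ω] (P : Measure Ω)
    (ℱ : Filtration ℤ mΩ) (α : ℤ → Ω → ℝ) (σ τ : ℝ) : Prop where
  adapted : ∀ t, Measurable[ℱ t] (α t)
  memLp : ∀ t, MemLp (α t) 4 P
  condMean : ∀ t, P[α t | ℱ (t - 1)] =ᵐ[P] fun _ => 0
  condVar : ∀ t, P[fun ω => (α t ω) ^ 2 | ℱ (t - 1)] =ᵐ[P] fun _ => σ ^ 2
  fourth : ∀ t, ∫ ω, (α t ω) ^ 4 ∂P ≤ τ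

section Moments

variable {Ω : Type*} [mΩ : MeasurableSpace Ω] {P : Measure Ω}

lemma integral_mul_eq_zero_of_condExp_eq_zero {m : MeasurableSpace Ω} (hm : m ≤ mΩ)
    [IsFiniteMeasure P] {f g : Ω → ℝ} (hg : Measurable[m] g) (hf : Integrable f P)
    (hfg : Integrable (fun ω => f ω * g ω) P) (h : P[f | m] =ᵐ[P] fun _ => 0) :
    ∫ ω, f ω * g ω ∂P = 0 := by
  have h1 : P[f * g | m] =ᵐ[P] P[f | m] * g :=
    condExp_mul_of_stronglyMeasurable_right hg.stronglyMeasurable hfg hf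
  have h2 : ∫ ω, (P[f * g | m]) ω ∂P = ∫ ω, (f * g) ω ∂P := integral_condExp hm
  have h3 : P[f * g | m] =ᵐ[P] fun _ => 0 := by
    filter_upwards [h1, h] with ω h1 h
    simp [h1, h]
  change ∫ ω, (f * g) ω ∂P = 0
  rw [← h2, integral_congr_ae h3, integral_zero]

lemma integral_sq_sum_of_orthogonal {ι : Type*} (F : Finset ι) (d : ι → Ω → ℝ)
    (hd : ∀ s ∈ F, MemLp (d s) 2 P)
    (ho : ∀ s ∈ F, ∀ t ∈ F, s ≠ t → ∫ ω, d s ω * d t ω ∂P = 0) :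
    ∫ ω, (∑ s ∈ F, d s ω) ^ 2 ∂P = ∑ s ∈ F, ∫ ω, (d s ω) ^ 2 ∂P := by
  have hint : ∀ s ∈ F, ∀ t ∈ F, Integrable (fun ω => d s ω * d t ω) P := fun s hs t ht =>
    (hd s hs).integrable_mul (hd t ht)
  simp_rw [sq, Finset.sum_mul_sum]
  rw [integral_finsetSum _ fun s hs => integrable_finsetSum _ fun t ht => hint s hs t ht]
  refine Finset.sum_congr rfl fun s hs => ?_
  rw [integral_finsetSum _ fun t ht => hint s hs t ht]
  exact Finset.sum_eq_single_of_mem s hs fun t ht hts => ho s hs t ht (Ne.symm hts)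

lemma memLp_two_mul {f g : Ω → ℝ} (hf : MemLp f 4 P) (hg : MemLp g 4 P) :
    MemLp (fun ω => f ω * g ω) 2 P := by
  have : ENNReal.HolderTriple 4 4 2 := ⟨by
    rw [← ENNReal.toReal_eq_toReal_iff' (by simp) (by simp), ENNReal.toReal_add (by simp) (by simp)]
    norm_num⟩
  exact hg.mul hf

namespace IsHomoscedasticMDS

variable {ℱ : Filtration ℤ mΩ} {α : ℤ → Ω → ℝ} {σ τ : ℝ}

lemma tau_nonneg (h : IsHomoscedasticMDS P ℱ α σ τ) : 0 ≤ τ :=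
  (integral_nonneg fun ω => by positivity).trans (h.fourth 0)

lemma measurable_of_lt (h : IsHomoscedasticMDS P ℱ α σ τ) {s t : ℤ} (hst : s < t) :
    Measurable[ℱ (t - 1)] (α s) :=
  (h.adapted s).mono (ℱ.mono (by omega)) le_rfl

variable [IsProbabilityMeasure P]

lemma memLp_two (h : IsHomoscedasticMDS P ℱ α σ τ) (t : ℤ) : MemLp (α t) 2 P :=
  (h.memLp t).mono_exponent (by norm_num)

lemma integral_sq (h : IsHomoscedasticMDS P ℱ α σ τ) (t : ℤ) : ∫ ω, (α t ω) ^ 2 ∂P = σ ^ 2 := by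
  rw [← integral_condExp (ℱ.le (t - 1)), integral_congr_ae (h.condVar t)]
  simp

lemma memLp_sq_sub (h : IsHomoscedasticMDS P ℱ α σ τ) (t : ℤ) :
    MemLp (fun ω => (α t ω) ^ 2 - σ ^ 2) 2 P := by
  have := (memLp_two_mul (h.memLp t) (h.memLp t)).sub (memLp_const (σ ^ 2))
  refine this.ae_eq (ae_of_all _ fun ω => ?_)
  simp [sq]

lemma integral_mul_eq_zero (h : IsHomoscedasticMDS P ℱ α σ τ) {t : ℤ} {g : Ω → ℝ}
    (hg : Measurable[ℱ (t - 1)] g) (hi : Integrable (fun ω => α t ω * g ω) P) :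
    ∫ ω, α t ω * g ω ∂P = 0 :=
  integral_mul_eq_zero_of_condExp_eq_zero (ℱ.le _) hg ((h.memLp_two t).integrable (by norm_num)) hi
    (h.condMean t)

/-- Constant conditional variance makes `α² - σ²` a second martingale difference sequence, again
orthogonal to the past. -/
lemma integral_sq_sub_mul_eq_zero (h : IsHomoscedasticMDS P ℱ α σ τ) {t : ℤ} {g : Ω → ℝ}
    (hg : Measurable[ℱ (t - 1)] g) (hi : Integrable (fun ω => ((α t ω) ^ 2 - σ ^ 2) * g ω) P) :
    ∫ ω, ((α t ω) ^ 2 - σ ^ 2) * g ω ∂P = 0 := by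
  refine integral_mul_eq_zero_of_condExp_eq_zero (ℱ.le _) hg
    ((h.memLp_sq_sub t).integrable (by norm_num)) hi ?_
  have h1 := condExp_sub (m := ℱ (t - 1)) (h.memLp_two t).integrable_sq
    (integrable_const (μ := P) (σ ^ 2))
  filter_upwards [h1, h.condVar t] with ω h1 h2
  refine h1.trans ?_
  simp [h2, condExp_const (ℱ.le (t - 1))]

lemma integral_mul_of_lt (h : IsHomoscedasticMDS P ℱ α σ τ) {s t : ℤ} (hst : s < t) :
    ∫ ω, α t ω * α s ω ∂P = 0 :=
  h.integral_mul_eq_zero (h.measurable_of_lt hst) ((h.memLp_two t).integrable_mul (h.memLp_two s))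

lemma integral_mul_of_ne (h : IsHomoscedasticMDS P ℱ α σ τ) {s t : ℤ} (hst : s ≠ t) :
    ∫ ω, α s ω * α t ω ∂P = 0 := by
  rcases lt_or_gt_of_ne hst with hlt | hlt
  · simpa [mul_comm] using h.integral_mul_of_lt hlt
  · exact h.integral_mul_of_lt hlt

lemma integral_sum_mul_sum (h : IsHomoscedasticMDS P ℱ α σ τ) (F : Finset ℤ) (c d : ℤ → ℝ) :
    ∫ ω, (∑ s ∈ F, c s * α s ω) * (∑ s ∈ F, d s * α s ω) ∂P = σ ^ 2 * ∑ s ∈ F, c s * d s := by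
  have hint : ∀ s t, Integrable (fun ω => c s * α s ω * (d t * α t ω)) P := fun s t =>
    ((h.memLp_two s).const_mul (c s)).integrable_mul ((h.memLp_two t).const_mul (d t))
  simp_rw [Finset.sum_mul_sum]
  rw [integral_finsetSum _ fun s hs => integrable_finsetSum _ fun t ht => hint s t, Finset.mul_sum]
  refine Finset.sum_congr rfl fun s hs => ?_
  rw [integral_finsetSum _ fun t ht => hint s t]
  have : ∀ t, ∫ ω, c s * α s ω * (d t * α t ω) ∂P = c s * d t * ∫ ω, α s ω * α t ω ∂P := by
    intro t
    rw [← integral_const_mul]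
    congr 1 with ω
    ring
  simp_rw [this]
  rw [Finset.sum_eq_single_of_mem s hs fun t ht hts => by
    rw [h.integral_mul_of_ne (Ne.symm hts), mul_zero]]
  simp_rw [← sq, h.integral_sq]
  ring

lemma integral_sq_sub_sq_le (h : IsHomoscedasticMDS P ℱ α σ τ) (t : ℤ) :
    ∫ ω, ((α t ω) ^ 2 - σ ^ 2) ^ 2 ∂P ≤ τ := by
  have h4 : Integrable (fun ω => (α t ω) ^ 4) P := by
    have := (memLp_two_mul (h.memLp t) (h.memLp t)).integrable_sq
    refine this.congr (ae_of_all _ fun ω => ?_)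
    ring_nf
  have h2 := (h.memLp_two t).integrable_sq
  have : ∀ ω, ((α t ω) ^ 2 - σ ^ 2) ^ 2 = (α t ω) ^ 4 - 2 * σ ^ 2 * (α t ω) ^ 2 + σ ^ 4 := by
    intro ω; ring
  simp_rw [this]
  have i3 : Integrable (fun ω => (α t ω) ^ 4 - 2 * σ ^ 2 * (α t ω) ^ 2) P :=
    h4.sub (h2.const_mul _)
  rw [integral_add i3 (integrable_const _),
    integral_sub h4 (h2.const_mul _), integral_const_mul, h.integral_sq]
  have := h.fourth t
  simp
  nlinarith [sq_nonneg (σ ^ 2)]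

/-- The variance of a quadratic form in martingale differences is controlled by the Frobenius norm
of its matrix. -/
lemma integral_quadratic_sq_le (h : IsHomoscedasticMDS P ℱ α σ τ) (F : Finset ℤ)
    (A : ℤ → ℤ → ℝ) (hA : ∀ s r, A s r = A r s) :
    MemLp (fun ω => (∑ s ∈ F, ∑ r ∈ F, A s r * (α s ω * α r ω)) - σ ^ 2 * ∑ s ∈ F, A s s) 2 P ∧
    ∫ ω, ((∑ s ∈ F, ∑ r ∈ F, A s r * (α s ω * α r ω)) - σ ^ 2 * ∑ s ∈ F, A s s) ^ 2 ∂P ≤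
      (2 * τ + 8 * σ ^ 4) * ∑ s ∈ F, ∑ r ∈ F, (A s r) ^ 2 := by
  set G : ℤ → Ω → ℝ := fun s ω => ∑ r ∈ F with r < s, A s r * α r ω with hG
  -- By symmetry of `A`, the pairs with later index `s` contribute twice their lower-triangular
  -- part. Thus `d s` collects all terms whose latest innovation is `α s`, and the `d s` are
  -- martingale increments.
  set d : ℤ → Ω → ℝ := fun s ω => A s s * ((α s ω) ^ 2 - σ ^ 2) + 2 * (α s ω * G s ω) with hd
  have hG4 : ∀ s, MemLp (G s) 4 P := fun s =>
    memLp_finsetSum _ fun r _ => (h.memLp r).const_mul _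
  have hG2 : ∀ s, MemLp (G s) 2 P := fun s => (hG4 s).mono_exponent (by norm_num)
  have hGm : ∀ s, Measurable[ℱ (s - 1)] (G s) := fun s =>
    Finset.measurable_sum _ fun r hr => (h.measurable_of_lt (Finset.mem_filter.1 hr).2).const_mul _
  have haG : ∀ s, MemLp (fun ω => α s ω * G s ω) 2 P := fun s => memLp_two_mul (h.memLp s) (hG4 s)
  have hd2 : ∀ s, MemLp (d s) 2 P := fun s =>
    ((h.memLp_sq_sub s).const_mul _).add ((haG s).const_mul 2)
  have hdm : ∀ s t, s < t → Measurable[ℱ (t - 1)] (d s) := by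
    intro s t hst
    have h1 := h.measurable_of_lt hst
    have h2 : Measurable[ℱ (t - 1)] (G s) := (hGm s).mono (ℱ.mono (by omega)) le_rfl
    exact ((((h1.pow_const 2).sub_const _).const_mul _).add ((h1.mul h2).const_mul 2))
  have hsum : ∀ ω, (∑ s ∈ F, ∑ r ∈ F, A s r * (α s ω * α r ω)) - σ ^ 2 * ∑ s ∈ F, A s s =
      ∑ s ∈ F, d s ω := by
    intro ω
    have hsplit : ∀ s ∈ F, ∑ r ∈ F, A s r * (α s ω * α r ω) =
        A s s * (α s ω) ^ 2 + (∑ r ∈ F with r < s, A s r * (α s ω * α r ω)) +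
          ∑ r ∈ F with s < r, A s r * (α s ω * α r ω) := by
      intro s hs
      have e1 := Finset.sum_filter_add_sum_filter_not F (fun r => r < s)
        (fun r => A s r * (α s ω * α r ω))
      have e2 := Finset.sum_filter_add_sum_filter_not (F.filter fun r => ¬ r < s) (fun r => s < r)
        (fun r => A s r * (α s ω * α r ω))
      rw [← e1, ← e2, Finset.filter_filter, Finset.filter_filter]
      have f1 : (F.filter fun r => ¬ r < s ∧ s < r) = F.filter fun r => s < r := by
        ext r; simp; omega
      have f2 : (F.filter fun r => ¬ r < s ∧ ¬ s < r) = {s} := by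
        ext r; simp; constructor
        · rintro ⟨_, _, _⟩; omega
        · rintro rfl; simp [hs]
      rw [f1, f2, Finset.sum_singleton]
      ring
    have hswap : ∑ s ∈ F, ∑ r ∈ F with s < r, A s r * (α s ω * α r ω) =
        ∑ s ∈ F, ∑ r ∈ F with r < s, A s r * (α s ω * α r ω) := by
      simp_rw [Finset.sum_filter]
      rw [Finset.sum_comm]
      refine Finset.sum_congr rfl fun s _ => Finset.sum_congr rfl fun r _ => ?_
      rw [hA r s, mul_comm (α r ω)]
    rw [Finset.sum_congr rfl hsplit, Finset.sum_add_distrib, Finset.sum_add_distrib, hswap,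
      Finset.mul_sum]
    simp only [hd, hG, Finset.mul_sum, Finset.sum_add_distrib, mul_sub, Finset.sum_sub_distrib]
    have : ∀ s r, 2 * (α s ω * (A s r * α r ω)) =
        A s r * (α s ω * α r ω) + A s r * (α s ω * α r ω) := by intro s r; ring
    simp_rw [this, Finset.sum_add_distrib]
    have : ∑ s ∈ F, σ ^ 2 * A s s = ∑ s ∈ F, A s s * σ ^ 2 :=
      Finset.sum_congr rfl fun s _ => mul_comm _ _
    rw [this]
    ring
  have hort : ∀ s t, s < t → ∫ ω, d t ω * d s ω ∂P = 0 := by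
    intro s t hst
    have i1 : Integrable (fun ω => ((α t ω) ^ 2 - σ ^ 2) * d s ω) P :=
      (h.memLp_sq_sub t).integrable_mul (hd2 s)
    have i2 : Integrable (fun ω => α t ω * (G t ω * d s ω)) P := by
      have : Integrable (fun ω => (α t ω * G t ω) * d s ω) P := (haG t).integrable_mul (hd2 s)
      simpa only [mul_assoc] using this
    have e1 := h.integral_sq_sub_mul_eq_zero (hdm s t hst) i1
    have e2 : ∫ ω, α t ω * (G t ω * d s ω) ∂P = 0 :=
      h.integral_mul_eq_zero ((hGm t).mul (hdm s t hst)) i2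
    calc ∫ ω, d t ω * d s ω ∂P
        = ∫ ω, (A t t * (((α t ω) ^ 2 - σ ^ 2) * d s ω) + 2 * (α t ω * (G t ω * d s ω))) ∂P := by
          refine integral_congr_ae (ae_of_all _ fun ω => ?_)
          change d t ω * d s ω = _
          have : d t ω = A t t * ((α t ω) ^ 2 - σ ^ 2) + 2 * (α t ω * G t ω) := rfl
          rw [this]; ring
      _ = 0 := by
          rw [integral_add (i1.const_mul _) (i2.const_mul _), integral_const_mul,
            integral_const_mul, e1, e2]
          simp
  -- From `(u + 2 v)² ≤ 2 u² + 8 v²`, and `E (α_s G_s)² = σ² E G_s²` because `G s` depends only on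
  -- the past.
  have hvar : ∀ s, ∫ ω, (d s ω) ^ 2 ∂P ≤
      2 * (A s s) ^ 2 * τ + 8 * σ ^ 4 * ∑ r ∈ F with r < s, (A s r) ^ 2 := by
    intro s
    have i1 := (h.memLp_sq_sub s).integrable_sq
    have i2 := (haG s).integrable_sq
    have i3 := (hG2 s).integrable_sq
    have e1 : ∫ ω, (G s ω) ^ 2 ∂P = σ ^ 2 * ∑ r ∈ F with r < s, (A s r) ^ 2 := by
      have := h.integral_sum_mul_sum (F.filter fun r => r < s) (A s) (A s)
      simpa only [← sq] using this
    have e2 : ∫ ω, (α s ω * G s ω) ^ 2 ∂P = σ ^ 2 * ∫ ω, (G s ω) ^ 2 ∂P := by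
      have hi : Integrable (fun ω => ((α s ω) ^ 2 - σ ^ 2) * (G s ω) ^ 2) P := by
        refine (i2.sub (i3.const_mul (σ ^ 2))).congr (ae_of_all _ fun ω => ?_)
        simp; ring
      have := h.integral_sq_sub_mul_eq_zero ((hGm s).pow_const 2) hi
      rw [← integral_const_mul, ← sub_eq_zero, ← integral_sub i2 (i3.const_mul _), ← this]
      congr 1 with ω
      ring
    calc ∫ ω, (d s ω) ^ 2 ∂P
        ≤ ∫ ω, (2 * (A s s) ^ 2 * ((α s ω) ^ 2 - σ ^ 2) ^ 2 + 8 * (α s ω * G s ω) ^ 2) ∂P := by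
          refine integral_mono (hd2 s).integrable_sq ((i1.const_mul _).add (i2.const_mul _))
            fun ω => ?_
          simp only [hd]
          nlinarith [sq_nonneg (A s s * ((α s ω) ^ 2 - σ ^ 2) - 2 * (α s ω * G s ω))]
      _ = 2 * (A s s) ^ 2 * ∫ ω, ((α s ω) ^ 2 - σ ^ 2) ^ 2 ∂P +
            8 * (σ ^ 2 * (σ ^ 2 * ∑ r ∈ F with r < s, (A s r) ^ 2)) := by
          rw [integral_add (i1.const_mul _) (i2.const_mul _), integral_const_mul,
            integral_const_mul, e2, e1]
      _ ≤ _ := by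
          have := mul_le_mul_of_nonneg_left (h.integral_sq_sub_sq_le s)
            (by positivity : 0 ≤ 2 * (A s s) ^ 2)
          linarith
  have hτ := h.tau_nonneg
  simp_rw [hsum]
  refine ⟨memLp_finsetSum _ fun s _ => hd2 s, ?_⟩
  rw [integral_sq_sum_of_orthogonal F d (fun s _ => hd2 s)]
  · rw [Finset.mul_sum]
    refine Finset.sum_le_sum fun s hs => (hvar s).trans ?_
    have h1 : (A s s) ^ 2 ≤ ∑ r ∈ F, (A s r) ^ 2 :=
      Finset.single_le_sum (f := fun r => (A s r) ^ 2) (fun r _ => sq_nonneg _) hs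
    have h2 : ∑ r ∈ F with r < s, (A s r) ^ 2 ≤ ∑ r ∈ F, (A s r) ^ 2 :=
      Finset.sum_le_sum_of_subset_of_nonneg (Finset.filter_subset _ _) fun r _ _ => sq_nonneg _
    have h3 := mul_le_mul_of_nonneg_left h1 (by positivity : 0 ≤ 2 * τ)
    have h4 := mul_le_mul_of_nonneg_left h2 (by positivity : 0 ≤ 8 * σ ^ 4)
    nlinarith
  · intro s _ t _ hst
    rcases lt_or_gt_of_ne hst with hlt | hlt
    · simpa [mul_comm] using hort s t hlt
    · exact hort t s hlt

end IsHomoscedasticMDS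

end Moments

/-! ### Quadratic forms in linear processes -/

/-- The coefficient of `α (t - j)` in the moving average representation of `e t`. -/
def lagCoeff (β : ℕ → ℝ) (j : ℤ) : ℝ := if 0 ≤ j then β j.toNat else 0

/-- The part of the moving average for `e t` involving the innovations from time `1 - T` on. -/
def truncMA {Ω : Type*} (β : ℕ → ℝ) (α : ℤ → Ω → ℝ) (T : ℕ) (t : ℤ) (ω : Ω) : ℝ :=
  ∑ k ∈ Finset.range (T + t.toNat), β k * α (t - k) ω

/-- Future innovations have coefficient zero, so a single window of innovations serves all times up
to `n`; this makes the truncated error vector a fixed matrix times an innovation vector. -/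
lemma truncMA_eq_sum_Ioc {Ω : Type*} (β : ℕ → ℝ) (α : ℤ → Ω → ℝ) (T n : ℕ) {t : ℤ} (ht : 0 ≤ t)
    (htn : t ≤ n) (ω : Ω) :
    truncMA β α T t ω = ∑ s ∈ Finset.Ioc (-(T : ℤ)) n, lagCoeff β (t - s) * α s ω := by
  have h1 : ∑ s ∈ Finset.Ioc (-(T : ℤ)) n, lagCoeff β (t - s) * α s ω =
      ∑ s ∈ Finset.Ioc (-(T : ℤ)) t, lagCoeff β (t - s) * α s ω := by
    symm
    refine Finset.sum_subset (Finset.Ioc_subset_Ioc_right htn) fun s hs hs' => ?_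
    simp only [Finset.mem_Ioc, not_and, not_le] at hs hs'
    have := hs' hs.1
    simp [lagCoeff, this]
  rw [h1, truncMA]
  refine Finset.sum_nbij' (fun k => t - k) (fun s => (t - s).toNat) ?_ ?_ ?_ ?_ ?_
  · intro k hk; simp at hk ⊢; omega
  · intro s hs; simp at hs ⊢; omega
  · intro k hk; simp
  · intro s hs; simp at hs ⊢; omega
  · intro k hk; simp [lagCoeff]

lemma tendsto_truncMA {Ω : Type*} {α : ℤ → Ω → ℝ} {β : ℕ → ℝ} {t : ℤ} {ω : Ω} {y : ℝ}
    (he : HasSum (fun k : ℕ => β k * α (t - k) ω) y) :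
    Tendsto (fun T => truncMA β α T t ω) atTop (𝓝 y) :=
  he.tendsto_sum_nat.comp (tendsto_add_atTop_nat t.toNat)

/-- The coefficients of the truncated errors `1, …, n` in terms of the innovations. -/
def lagMatrix (β : ℕ → ℝ) (n T : ℕ) : Matrix (Fin n) (Finset.Ioc (-(T : ℤ)) n) ℝ :=
  Matrix.of fun i s => lagCoeff β ((i : ℕ) + 1 - s)

lemma truncMA_eq_mulVec {Ω : Type*} {α : ℤ → Ω → ℝ} {β : ℕ → ℝ} (T n : ℕ)
    (i : Fin n) (ω : Ω) :
    truncMA β α T ((i : ℕ) + 1) ω = (lagMatrix β n T *ᵥ fun s => α s ω) i := by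
  rw [truncMA_eq_sum_Ioc β α T n (by positivity) (by exact_mod_cast i.2), Matrix.mulVec,
    dotProduct, ← Finset.sum_coe_sort]
  rfl

section

variable {Ω : Type*} [mΩ : MeasurableSpace Ω] {P : Measure Ω} [IsProbabilityMeasure P]
variable {ℱ : Filtration ℤ mΩ} {α : ℤ → Ω → ℝ} {σ τ : ℝ} {β : ℕ → ℝ} {e : ℤ → Ω → ℝ}

/-- Cauchy–Schwarz with weights `|β k|` bounds every truncation by `(∑ |β k|) (∑ |β k| α²)`, which
is integrable since the innovations share one variance. It is the majorant needed for convergence of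
the covariances. -/
lemma IsHomoscedasticMDS.exists_truncMA_bound (h : IsHomoscedasticMDS P ℱ α σ τ)
    (hβ : Summable fun k => |β k|) (t : ℤ) :
    ∃ g : Ω → ℝ, Integrable g P ∧ ∀ᵐ ω ∂P, ∀ T, (truncMA β α T t ω) ^ 2 ≤ g ω := by
  set f : ℕ → Ω → ENNReal := fun k ω => ENNReal.ofReal (|β k| * (α (t - k) ω) ^ 2) with hf
  have hαm : ∀ s, Measurable (α s) := fun s => (h.adapted s).mono (ℱ.le s) le_rfl
  have hfm : ∀ k, Measurable (f k) := fun k =>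
    (((hαm _).pow_const 2).const_mul _).ennreal_ofReal
  have hint : ∀ k, ∫⁻ ω, f k ω ∂P = ENNReal.ofReal (|β k| * σ ^ 2) := by
    intro k
    rw [← ofReal_integral_eq_lintegral_ofReal ((h.memLp_two _).integrable_sq.const_mul _)
      (ae_of_all _ fun ω => by positivity), integral_const_mul, h.integral_sq]
  have htot : ∫⁻ ω, ∑' k, f k ω ∂P ≠ ⊤ := by
    rw [lintegral_tsum fun k => (hfm k).aemeasurable]
    simp_rw [hint]
    exact (hβ.mul_right (σ ^ 2)).tsum_ofReal_ne_top
  have hm : AEMeasurable (fun ω => ∑' k, f k ω) P := (Measurable.tsum hfm).aemeasurable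
  refine ⟨fun ω => (∑' k, |β k|) * (∑' k, f k ω).toReal,
    (integrable_toReal_of_lintegral_ne_top hm htot).const_mul _, ?_⟩
  filter_upwards [ae_lt_top' hm htot] with ω hω T
  have hcs : (truncMA β α T t ω) ^ 2 ≤ (∑ k ∈ Finset.range (T + t.toNat), |β k|) *
      ∑ k ∈ Finset.range (T + t.toNat), |β k| * (α (t - k) ω) ^ 2 :=
    Finset.sum_sq_le_sum_mul_sum_of_sq_le_mul _ (fun _ _ => abs_nonneg _)
      (fun _ _ => by positivity) fun k _ => le_of_eq (by rw [← mul_assoc, ← sq, sq_abs]; ring)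
  refine hcs.trans (mul_le_mul (hβ.sum_le_tsum _ fun _ _ => abs_nonneg _) ?_
    (Finset.sum_nonneg fun _ _ => by positivity) (tsum_nonneg fun _ => abs_nonneg _))
  rw [← ENNReal.ofReal_le_iff_le_toReal hω.ne, ENNReal.ofReal_sum_of_nonneg fun _ _ => by positivity]
  exact ENNReal.sum_le_tsum _

lemma IsHomoscedasticMDS.tendsto_integral_truncMA (h : IsHomoscedasticMDS P ℱ α σ τ)
    (hβ : Summable fun k => |β k|)
    (he : ∀ t, ∀ᵐ ω ∂P, HasSum (fun k : ℕ => β k * α (t - k) ω) (e t ω)) (s t : ℤ) :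
    Tendsto (fun T => ∫ ω, truncMA β α T s ω * truncMA β α T t ω ∂P) atTop
      (𝓝 (∫ ω, e s ω * e t ω ∂P)) := by
  obtain ⟨g₁, hg₁, hb₁⟩ := h.exists_truncMA_bound hβ s
  obtain ⟨g₂, hg₂, hb₂⟩ := h.exists_truncMA_bound hβ t
  have hαm : ∀ s, Measurable (α s) := fun s => (h.adapted s).mono (ℱ.le s) le_rfl
  have hm : ∀ T t, Measurable (truncMA β α T t) := fun T t =>
    Finset.measurable_sum _ fun k _ => (hαm _).const_mul _
  refine tendsto_integral_of_dominated_convergence (fun ω => g₁ ω + g₂ ω)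
    (fun T => ((hm T s).mul (hm T t)).aestronglyMeasurable) (hg₁.add hg₂) (fun T => ?_) ?_
  · filter_upwards [hb₁, hb₂] with ω h₁ h₂
    rw [Real.norm_eq_abs, abs_mul]
    have := h₁ T
    have := h₂ T
    have := sq_abs (truncMA β α T s ω)
    have := sq_abs (truncMA β α T t ω)
    nlinarith [sq_nonneg (|truncMA β α T s ω| - |truncMA β α T t ω|),
      sq_nonneg (truncMA β α T s ω), sq_nonneg (truncMA β α T t ω)]
  · filter_upwards [he s, he t] with ω h₁ h₂
    exact (tendsto_truncMA h₁).mul (tendsto_truncMA h₂)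

lemma IsHomoscedasticMDS.integral_truncMA_mul (h : IsHomoscedasticMDS P ℱ α σ τ) (T n : ℕ)
    (i j : Fin n) :
    ∫ ω, truncMA β α T ((i : ℕ) + 1) ω * truncMA β α T ((j : ℕ) + 1) ω ∂P =
      (σ ^ 2 • (lagMatrix β n T * (lagMatrix β n T)ᵀ)) i j := by
  simp_rw [truncMA_eq_sum_Ioc β α T n (t := (i : ℕ) + 1) (by positivity) (by exact_mod_cast i.2),
    truncMA_eq_sum_Ioc β α T n (t := (j : ℕ) + 1) (by positivity) (by exact_mod_cast j.2)]
  rw [h.integral_sum_mul_sum, Matrix.smul_apply, Matrix.mul_apply, smul_eq_mul,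
    ← Finset.sum_coe_sort]
  rfl

lemma IsHomoscedasticMDS.tendsto_lagMatrix (h : IsHomoscedasticMDS P ℱ α σ τ)
    (hβ : Summable fun k => |β k|)
    (he : ∀ t, ∀ᵐ ω ∂P, HasSum (fun k : ℕ => β k * α (t - k) ω) (e t ω)) (n : ℕ) :
    Tendsto (fun T => σ ^ 2 • (lagMatrix β n T * (lagMatrix β n T)ᵀ)) atTop
      (𝓝 (errCov P e n)) := by
  refine tendsto_pi_nhds.2 fun i => tendsto_pi_nhds.2 fun j => ?_
  simp_rw [← h.integral_truncMA_mul]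
  exact h.tendsto_integral_truncMA hβ he _ _

/-- If `i` is the last nonzero coordinate of `v`, the innovation at the time of `i` enters `∑ v_j
e_j` only through `e_i`, with coefficient `v i * β 0 = v i`. So the variance is at least `σ² (v
i)²`, uniformly in the truncation. -/
lemma IsHomoscedasticMDS.errCov_posDef (h : IsHomoscedasticMDS P ℱ α σ τ)
    (hβ : Summable fun k => |β k|) (hβ0 : β 0 = 1) (hσ : σ ≠ 0)
    (he : ∀ t, ∀ᵐ ω ∂P, HasSum (fun k : ℕ => β k * α (t - k) ω) (e t ω)) (n : ℕ) :
    (errCov P e n).PosDef := by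
  refine Matrix.PosDef.of_dotProduct_mulVec_pos ?_ fun v hv => ?_
  · ext i j
    simp [errCov, Matrix.conjTranspose_apply, mul_comm]
  · obtain ⟨i, hi, hmax⟩ : ∃ i, v i ≠ 0 ∧ ∀ j, i < j → v j = 0 := by
      have hne : (Finset.univ.filter fun i => v i ≠ 0).Nonempty := by
        obtain ⟨i, hi⟩ := Function.ne_iff.1 hv
        exact ⟨i, by simpa using hi⟩
      refine ⟨_, (Finset.mem_filter.1 (Finset.max'_mem _ hne)).2, fun j hj => ?_⟩
      by_contra hj0
      exact absurd (Finset.le_max' _ j (by simp [hj0])) (not_le.2 hj)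
    have hlim : Tendsto (fun T => v ⬝ᵥ ((σ ^ 2 • (lagMatrix β n T * (lagMatrix β n T)ᵀ)) *ᵥ v))
        atTop (𝓝 (v ⬝ᵥ (errCov P e n *ᵥ v))) := by
      have hc : Continuous fun A : Matrix (Fin n) (Fin n) ℝ => v ⬝ᵥ (A *ᵥ v) := by fun_prop
      exact (hc.tendsto _).comp (h.tendsto_lagMatrix hβ he n)
    have hlow : ∀ T, σ ^ 2 * (v i) ^ 2 ≤
        v ⬝ᵥ ((σ ^ 2 • (lagMatrix β n T * (lagMatrix β n T)ᵀ)) *ᵥ v) := by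
      intro T
      have e1 : v ⬝ᵥ ((σ ^ 2 • (lagMatrix β n T * (lagMatrix β n T)ᵀ)) *ᵥ v) =
          σ ^ 2 * ∑ s, ((v ᵥ* lagMatrix β n T) s) ^ 2 := by
        rw [Matrix.smul_mulVec, dotProduct_smul, ← Matrix.mulVec_mulVec, Matrix.dotProduct_mulVec,
          Matrix.mulVec_transpose, smul_eq_mul, dotProduct]
        simp_rw [sq]
      rw [e1]
      refine mul_le_mul_of_nonneg_left ?_ (sq_nonneg σ)
      set s₀ : Finset.Ioc (-(T : ℤ)) n := ⟨(i : ℕ) + 1, by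
        have := i.2
        simp only [Finset.mem_Ioc]; omega⟩
      have e2 : (v ᵥ* lagMatrix β n T) s₀ = v i := by
        rw [Matrix.vecMul, dotProduct, Finset.sum_eq_single i]
        · simp [lagMatrix, lagCoeff, s₀, hβ0]
        · intro j _ hj
          rcases lt_or_gt_of_ne hj with hlt | hlt
          · simp [lagMatrix, lagCoeff, s₀, hlt]
          · simp [hmax j hlt]
        · simp
      rw [← e2]
      exact Finset.single_le_sum (f := fun s => ((v ᵥ* lagMatrix β n T) s) ^ 2)
        (fun s _ => sq_nonneg _) (Finset.mem_univ s₀)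
    have := ge_of_tendsto' hlim hlow
    simp only [star_trivial]
    exact lt_of_lt_of_le (by positivity) this

/-- With errors `L α` the form has matrix `A = Lᵀ B L` in the innovations. Cyclicity of the trace
turns `tr A` and `‖A‖² = tr (A A)` into traces of `B (L Lᵀ)` and its square, which removes `L` and
prepares the limit in `T`. -/
lemma IsHomoscedasticMDS.lintegral_quadratic_truncMA_le (h : IsHomoscedasticMDS P ℱ α σ τ)
    (hσ : σ ≠ 0) {n : ℕ} (B : Matrix (Fin n) (Fin n) ℝ) (hB : Bᵀ = B) (T : ℕ) :
    ∫⁻ ω, ENNReal.ofReal (((fun i : Fin n => truncMA β α T ((i : ℕ) + 1) ω) ⬝ᵥ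
        (B *ᵥ fun i : Fin n => truncMA β α T ((i : ℕ) + 1) ω) -
          (B * (σ ^ 2 • (lagMatrix β n T * (lagMatrix β n T)ᵀ))).trace) ^ 2) ∂P ≤
      ENNReal.ofReal ((2 * τ + 8 * σ ^ 4) / σ ^ 4 *
        (B * (σ ^ 2 • (lagMatrix β n T * (lagMatrix β n T)ᵀ)) *
          (B * (σ ^ 2 • (lagMatrix β n T * (lagMatrix β n T)ᵀ)))).trace) := by
  set E : Ω → Fin n → ℝ := fun ω i => truncMA β α T ((i : ℕ) + 1) ω with hE
  set F := Finset.Ioc (-(T : ℤ)) n with hF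
  set L := lagMatrix β n T with hL
  set A : Matrix F F ℝ := Lᵀ * B * L with hA
  set A' : ℤ → ℤ → ℝ := fun s r =>
    if hs : s ∈ F then if hr : r ∈ F then A ⟨s, hs⟩ ⟨r, hr⟩ else 0 else 0 with hA'
  have hAsymm : Aᵀ = A := by
    simp [hA, Matrix.transpose_mul, hB, Matrix.mul_assoc]
  have hA'A : ∀ s r : F, A' s r = A s r := fun s r => by simp [hA']
  have hA'symm : ∀ s r, A' s r = A' r s := by
    intro s r
    simp only [hA']
    split_ifs with h1 h2
    · conv_lhs => rw [← hAsymm]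
      rfl
    all_goals rfl
  obtain ⟨hmem, hle⟩ := h.integral_quadratic_sq_le F A' hA'symm
  have e1 : ∀ ω, ∑ s ∈ F, ∑ r ∈ F, A' s r * (α s ω * α r ω) = E ω ⬝ᵥ (B *ᵥ E ω) := by
    intro ω
    have : E ω = L *ᵥ fun s : F => α s ω := by
      ext i
      exact truncMA_eq_mulVec T n i ω
    rw [this, Matrix.dotProduct_mulVec, Matrix.dotProduct_mulVec, ← Matrix.mulVec_transpose,
      ← Matrix.mulVec_transpose, hB, Matrix.mulVec_mulVec, Matrix.mulVec_mulVec,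
      ← hA, dotProduct_comm, dotProduct, ← Finset.sum_coe_sort]
    refine Finset.sum_congr rfl fun s _ => ?_
    rw [Matrix.mulVec, dotProduct, Finset.mul_sum, ← Finset.sum_coe_sort]
    refine Finset.sum_congr rfl fun r _ => ?_
    rw [hA'A]
    ring
  have e2 : σ ^ 2 * ∑ s ∈ F, A' s s = (B * (σ ^ 2 • (L * Lᵀ))).trace := by
    rw [← Finset.sum_coe_sort]
    simp_rw [hA'A]
    change σ ^ 2 * A.trace = _
    simp only [hA, Matrix.mul_smul, Matrix.trace_smul, smul_eq_mul]
    rw [Matrix.mul_assoc, Matrix.trace_mul_comm, Matrix.mul_assoc]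
  have e3 : (2 * τ + 8 * σ ^ 4) * ∑ s ∈ F, ∑ r ∈ F, (A' s r) ^ 2 =
      (2 * τ + 8 * σ ^ 4) / σ ^ 4 * (B * (σ ^ 2 • (L * Lᵀ)) * (B * (σ ^ 2 • (L * Lᵀ)))).trace := by
    have : ∑ s ∈ F, ∑ r ∈ F, (A' s r) ^ 2 = (A * A).trace := by
      rw [← Finset.sum_coe_sort, Matrix.trace]
      refine Finset.sum_congr rfl fun s _ => ?_
      rw [← Finset.sum_coe_sort, Matrix.diag_apply, Matrix.mul_apply]
      refine Finset.sum_congr rfl fun r _ => ?_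
      rw [hA'A, sq]
      congr 1
      conv_lhs => rw [← hAsymm]
      rfl
    rw [this]
    have : (B * (σ ^ 2 • (L * Lᵀ)) * (B * (σ ^ 2 • (L * Lᵀ)))).trace = σ ^ 4 * (A * A).trace := by
      simp only [hA, Matrix.mul_smul, Matrix.smul_mul, Matrix.trace_smul, smul_eq_mul]
      have : (B * (L * Lᵀ) * (B * (L * Lᵀ))).trace = (Lᵀ * B * L * (Lᵀ * B * L)).trace := by
        have : B * (L * Lᵀ) * (B * (L * Lᵀ)) = (B * L * Lᵀ * B * L) * Lᵀ := by
          simp only [Matrix.mul_assoc]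
        rw [this, Matrix.trace_mul_comm]
        simp only [Matrix.mul_assoc]
      rw [this]
      ring
    rw [this]
    field_simp
  simp_rw [e1, e2] at hmem hle
  rw [e3] at hle
  rw [← ofReal_integral_eq_lintegral_ofReal hmem.integrable_sq
    (ae_of_all _ fun ω => sq_nonneg _)]
  exact ENNReal.ofReal_le_ofReal hle
/-- The mean square deviation of a quadratic form in the errors. -/
theorem IsHomoscedasticMDS.lintegral_quadratic_errors_le (h : IsHomoscedasticMDS P ℱ α σ τ)
    (hβ : Summable fun k => |β k|) (hσ : σ ≠ 0)
    (he : ∀ t, ∀ᵐ ω ∂P, HasSum (fun k : ℕ => β k * α (t - k) ω) (e t ω)) {n : ℕ}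
    (B : Matrix (Fin n) (Fin n) ℝ) (hB : Bᵀ = B) :
    ∫⁻ ω, ENNReal.ofReal (((fun i : Fin n => e ((i : ℕ) + 1) ω) ⬝ᵥ
        (B *ᵥ fun i : Fin n => e ((i : ℕ) + 1) ω) - (B * errCov P e n).trace) ^ 2) ∂P ≤
      ENNReal.ofReal ((2 * τ + 8 * σ ^ 4) / σ ^ 4 *
        (B * errCov P e n * (B * errCov P e n)).trace) := by
  set V : ℕ → Matrix (Fin n) (Fin n) ℝ := fun T =>
    σ ^ 2 • (lagMatrix β n T * (lagMatrix β n T)ᵀ) with hV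
  have hVlim : Tendsto V atTop (𝓝 (errCov P e n)) := h.tendsto_lagMatrix hβ he n
  set E : ℕ → Ω → Fin n → ℝ := fun T ω i => truncMA β α T ((i : ℕ) + 1) ω with hE
  have hαm : ∀ s, Measurable (α s) := fun s => (h.adapted s).mono (ℱ.le s) le_rfl
  have hEm : ∀ T i, Measurable fun ω => E T ω i := fun T i =>
    Finset.measurable_sum _ fun k _ => (hαm _).const_mul _
  have hQm : ∀ T, Measurable fun ω =>
      ENNReal.ofReal ((E T ω ⬝ᵥ (B *ᵥ E T ω) - (B * V T).trace) ^ 2) := by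
    intro T
    refine Measurable.ennreal_ofReal (Measurable.pow_const (Measurable.sub_const ?_ _) 2)
    exact Finset.measurable_sum _ fun i _ => (hEm T i).mul
      (show Measurable fun ω => ∑ j, B i j * E T ω j from
        Finset.measurable_sum _ fun j _ => (hEm T j).const_mul _)
  have hbound := fun T => h.lintegral_quadratic_truncMA_le (β := β) hσ B hB T
  have hBV : Tendsto (fun T => B * V T) atTop (𝓝 (B * errCov P e n)) :=
    ((continuous_const.matrix_mul continuous_id).tendsto (errCov P e n)).comp hVlim
  have htr : Tendsto (fun T => (B * V T).trace) atTop (𝓝 (B * errCov P e n).trace) := by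
    have hc : Continuous fun A : Matrix (Fin n) (Fin n) ℝ => A.trace :=
      continuous_id.matrix_trace
    exact (hc.tendsto _).comp hBV
  have hlim : ∀ᵐ ω ∂P, Tendsto
      (fun T => ENNReal.ofReal ((E T ω ⬝ᵥ (B *ᵥ E T ω) - (B * V T).trace) ^ 2)) atTop
      (𝓝 (ENNReal.ofReal (((fun i : Fin n => e ((i : ℕ) + 1) ω) ⬝ᵥ
        (B *ᵥ fun i : Fin n => e ((i : ℕ) + 1) ω) - (B * errCov P e n).trace) ^ 2))) := by
    filter_upwards [ae_all_iff.2 he] with ω hω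
    have hE' : Tendsto (fun T => E T ω) atTop (𝓝 fun i : Fin n => e ((i : ℕ) + 1) ω) :=
      tendsto_pi_nhds.2 fun i => tendsto_truncMA (hω _)
    have hQ : Tendsto (fun T => E T ω ⬝ᵥ (B *ᵥ E T ω)) atTop
        (𝓝 ((fun i : Fin n => e ((i : ℕ) + 1) ω) ⬝ᵥ
          (B *ᵥ fun i : Fin n => e ((i : ℕ) + 1) ω))) := by
      have hc : Continuous fun v : Fin n → ℝ => v ⬝ᵥ (B *ᵥ v) := by fun_prop
      exact (hc.tendsto _).comp hE'
    exact ENNReal.tendsto_ofReal ((hQ.sub htr).pow 2)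
  have hlim' : Tendsto (fun T => ENNReal.ofReal
      ((2 * τ + 8 * σ ^ 4) / σ ^ 4 * (B * V T * (B * V T)).trace)) atTop
      (𝓝 (ENNReal.ofReal ((2 * τ + 8 * σ ^ 4) / σ ^ 4 *
        (B * errCov P e n * (B * errCov P e n)).trace))) := by
    refine ENNReal.tendsto_ofReal (Tendsto.const_mul _ ?_)
    have hc : Continuous fun A : Matrix (Fin n) (Fin n) ℝ => (A * A).trace :=
      (continuous_id.matrix_mul continuous_id).matrix_trace
    exact (hc.tendsto _).comp hBV
  -- Fatou's lemma: only almost sure convergence of the truncated forms is needed.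
  rw [lintegral_congr_ae (hlim.mono fun ω hω => hω.liminf_eq.symm)]
  refine (lintegral_liminf_le hQm).trans ?_
  rw [← hlim'.liminf_eq]
  exact liminf_le_liminf (Eventually.of_forall hbound)

end

/-! ### Comparison of criterion and loss over sparse weights -/

section Weights

variable {M N : ℕ} {δ : ℝ} {w : Fin M → ℝ}

lemma weightSet_nonneg (hδ : 0 < δ) (hw : w ∈ weightSet M N δ) (i : Fin M) : 0 ≤ w i := by
  simp only [weightSet, weightSetExact, Set.mem_iUnion] at hw
  obtain ⟨l, -, h, -⟩ := hw
  by_cases hi : w i = 0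
  · exact hi.ge
  · exact hδ.le.trans (h i hi).1

lemma weightSet_le (hw : w ∈ weightSet M N δ) {i : Fin M} (hi : w i ≠ 0) : δ ≤ w i := by
  simp only [weightSet, weightSetExact, Set.mem_iUnion] at hw
  obtain ⟨l, -, h, -⟩ := hw
  exact (h i hi).1

lemma weightSet_sum (hw : w ∈ weightSet M N δ) : ∑ i, w i = 1 := by
  simp only [weightSet, weightSetExact, Set.mem_iUnion] at hw
  obtain ⟨l, -, -, -, h⟩ := hw
  exact h

lemma abs_sum_mul_le (hw : ∀ i, 0 ≤ w i) (hsum : ∑ i, w i = 1) {K : ℝ} {c : Fin M → ℝ}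
    (hc : ∀ i, w i ≠ 0 → |c i| ≤ K) : |∑ i, w i * c i| ≤ K := by
  calc |∑ i, w i * c i| ≤ ∑ i, |w i * c i| := Finset.abs_sum_le_sum_abs _ _
    _ ≤ ∑ i, w i * K := Finset.sum_le_sum fun i _ => by
        rw [abs_mul, abs_of_nonneg (hw i)]
        by_cases hi : w i = 0
        · simp [hi]
        · exact mul_le_mul_of_nonneg_left (hc i hi) (hw i)
    _ = K := by rw [← Finset.sum_mul, hsum, one_mul]

/-- The averaged quadratic form `∑ m, ∑ l, w m * w l * c m l`. -/
def pairSum (w : Fin M → ℝ) (c : Fin M → Fin M → ℝ) : ℝ := ∑ m, w m * ∑ l, w l * c m l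

lemma abs_pairSum_le (hw : ∀ i, 0 ≤ w i) (hsum : ∑ i, w i = 1) {K : ℝ} {c : Fin M → Fin M → ℝ}
    (hc : ∀ i j, w i ≠ 0 → w j ≠ 0 → |c i j| ≤ K) : |pairSum w c| ≤ K :=
  abs_sum_mul_le hw hsum fun i hi => abs_sum_mul_le hw hsum fun j hj => hc i j hi hj

lemma pairSum_sub (c d : Fin M → Fin M → ℝ) :
    pairSum w c - pairSum w d = pairSum w fun m l => c m l - d m l := by
  simp only [pairSum, mul_sub, Finset.sum_sub_distrib]

lemma pairSum_add (c d : Fin M → Fin M → ℝ) :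
    pairSum w c + pairSum w d = pairSum w fun m l => c m l + d m l := by
  simp only [pairSum, mul_add, Finset.sum_add_distrib]

lemma pairSum_left (hsum : ∑ i, w i = 1) (c : Fin M → ℝ) :
    pairSum w (fun m _ => c m) = ∑ m, w m * c m := by
  simp only [pairSum, ← Finset.sum_mul, hsum, one_mul]

lemma pairSum_right (hsum : ∑ i, w i = 1) (c : Fin M → ℝ) :
    pairSum w (fun _ l => c l) = ∑ m, w m * c m := by
  simp only [pairSum, ← Finset.sum_mul, hsum, one_mul]

/-- The pair `{max m l, min m l}` is `{m, l}`, so a symmetric sum decouples; this is what makes the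
excess of criterion over loss linear in `w`. -/
lemma pairSum_max_add_min (hsum : ∑ i, w i = 1) (c : Fin M → ℝ) :
    (pairSum w fun m l => c (max m l) + c (min m l)) = 2 * ∑ m, w m * c m := by
  have : (fun m l => c (max m l) + c (min m l)) = fun m l => c m + c l := by
    ext m l
    rcases le_total m l with h | h
    · rw [max_eq_right h, min_eq_left h, add_comm]
    · rw [max_eq_left h, min_eq_right h]
  rw [this, ← pairSum_add, pairSum_left hsum, pairSum_right hsum, two_mul]

/-- The lower bound `δ` on active weights enters here: the single diagonal term `w m * w m * c m m`
already suffices. -/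
lemma le_pairSum_diag (hδ : 0 < δ) (hw : w ∈ weightSet M N δ) {c : Fin M → Fin M → ℝ}
    (hc : ∀ i j, 0 ≤ c i j) {m : Fin M} (hm : w m ≠ 0) : δ ^ 2 * c m m ≤ pairSum w c := by
  have h0 := weightSet_nonneg hδ hw
  have h1 := weightSet_le hw hm
  calc δ ^ 2 * c m m = δ * (δ * c m m) := by ring
    _ ≤ w m * (w m * c m m) := by
        have := mul_le_mul_of_nonneg_right h1 (hc m m)
        exact mul_le_mul h1 this (mul_nonneg hδ.le (hc m m)) (h0 m)
    _ ≤ w m * ∑ l, w l * c m l := by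
        refine mul_le_mul_of_nonneg_left ?_ (h0 m)
        exact Finset.single_le_sum (f := fun l => w l * c m l)
          (fun l _ => mul_nonneg (h0 l) (hc m l)) (Finset.mem_univ m)
    _ ≤ _ := Finset.single_le_sum (f := fun m => w m * ∑ l, w l * c m l)
          (fun m _ => mul_nonneg (h0 m) (Finset.sum_nonneg fun l _ => mul_nonneg (h0 l) (hc m l)))
          (Finset.mem_univ m)

/-- The loss in terms of the squared biases `b`, the noise energies `q` and the cross terms `a` of
nested models. -/
def nestedLoss (a b q : Fin M → ℝ) (w : Fin M → ℝ) : ℝ :=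
  pairSum w fun m l => b (max m l) + q (min m l) + a (max m l) - a (min m l)

/-- The criterion in terms of the same quantities, with `s` the total noise energy and `k` the
model dimensions. -/
def nestedCriterion (a b q k : Fin M → ℝ) (s : ℝ) (w : Fin M → ℝ) : ℝ :=
  (pairSum w fun m l => b (max m l) + 2 * a (max m l) + s - q (max m l)) + 2 * ∑ m, w m * k m

variable {a b q k : Fin M → ℝ} {s η : ℝ}

/-- The witness is the pair average of `b_max + k_min`, which dominates `δ² (b m + k m)` for every
active `m`. The first error consists of three terms of size `η R / δ²`, the second of twice two such
terms; hence the common factor `4`. -/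
lemma exists_risk_bounds (hδ : 0 < δ) (hb : ∀ m, 0 ≤ b m) (hk : ∀ m, 0 < k m) (hη : 0 ≤ η)
    (ha : ∀ m, |a m| ≤ η * (b m + k m)) (hq : ∀ m, |q m - k m| ≤ η * (b m + k m))
    (hw : w ∈ weightSet M N δ) :
    ∃ R, 0 < R ∧ |nestedLoss a b q w - R| ≤ 4 * η / δ ^ 2 * R ∧
      |nestedCriterion a b q k s w - s - nestedLoss a b q w| ≤ 4 * η / δ ^ 2 * R := by
  have h0 := weightSet_nonneg hδ hw
  have hsum := weightSet_sum hw
  set R := pairSum w fun m l => b (max m l) + k (min m l) with hR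
  have hD : ∀ m, w m ≠ 0 → b m + k m ≤ R / δ ^ 2 := fun m hm => by
    rw [le_div_iff₀ (by positivity), mul_comm]
    have := le_pairSum_diag hδ hw (c := fun m l => b (max m l) + k (min m l))
      (fun i j => add_nonneg (hb _) (hk _).le) hm
    simpa using this
  have hηD : ∀ m, w m ≠ 0 → η * (b m + k m) ≤ η * (R / δ ^ 2) := fun m hm =>
    mul_le_mul_of_nonneg_left (hD m hm) hη
  obtain ⟨m₀, hm₀⟩ : ∃ m, w m ≠ 0 := by
    by_contra! h
    simp [h] at hsum
  have hRpos : 0 < R := by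
    have h1 : 0 < R / δ ^ 2 := lt_of_lt_of_le (add_pos_of_nonneg_of_pos (hb m₀) (hk m₀)) (hD m₀ hm₀)
    exact (div_pos_iff_of_pos_right (by positivity)).1 h1
  -- The larger and the smaller of two active models are active themselves, so the bound by `R / δ ^
  -- 2` applies to them.
  have hmax : ∀ i j, w i ≠ 0 → w j ≠ 0 → w (max i j) ≠ 0 := fun i j hi hj => by
    rcases max_choice i j with h | h <;> rw [h] <;> assumption
  have hmin : ∀ i j, w i ≠ 0 → w j ≠ 0 → w (min i j) ≠ 0 := fun i j hi hj => by
    rcases min_choice i j with h | h <;> rw [h] <;> assumption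
  have hηR : 0 ≤ η * (R / δ ^ 2) := by positivity
  have hK : 4 * η / δ ^ 2 * R = 4 * (η * (R / δ ^ 2)) := by ring
  refine ⟨R, hRpos, ?_, ?_⟩
  · rw [hR, nestedLoss, pairSum_sub, ← hR, hK]
    refine abs_pairSum_le h0 hsum fun i j hi hj => ?_
    have h1 := abs_le.1 ((ha _).trans (hηD _ (hmax i j hi hj)))
    have h2 := abs_le.1 ((ha _).trans (hηD _ (hmin i j hi hj)))
    have h3 := abs_le.1 ((hq _).trans (hηD _ (hmin i j hi hj)))
    rw [abs_le]
    constructor <;> linarith [h1.1, h1.2, h2.1, h2.2, h3.1, h3.2]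
  · have e1 : nestedCriterion a b q k s w - s - nestedLoss a b q w =
        2 * ∑ m, w m * (a m - (q m - k m)) := by
      have hs : s = pairSum w fun _ _ => s := by
        rw [pairSum_left hsum fun _ => s, ← Finset.sum_mul, hsum, one_mul]
      have e2 : nestedCriterion a b q k s w - s - nestedLoss a b q w =
          (pairSum w fun m l => a (max m l) + a (min m l)) -
            (pairSum w fun m l => q (max m l) + q (min m l)) + 2 * ∑ m, w m * k m := by
        rw [nestedCriterion, nestedLoss]
        conv_lhs => enter [1, 2]; rw [hs]
        rw [add_sub_right_comm, pairSum_sub, add_sub_right_comm, pairSum_sub, pairSum_sub]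
        congr 2
        ext m l
        ring
      rw [e2, pairSum_max_add_min hsum, pairSum_max_add_min hsum]
      simp only [mul_sub, Finset.sum_sub_distrib]
      ring
    rw [e1, abs_mul, abs_two, hK]
    have : |∑ m, w m * (a m - (q m - k m))| ≤ 2 * (η * (R / δ ^ 2)) :=
      abs_sum_mul_le h0 hsum fun i hi => by
        have h1 := abs_le.1 ((ha _).trans (hηD _ hi))
        have h3 := abs_le.1 ((hq _).trans (hηD _ hi))
        rw [abs_le]
        constructor <;> linarith [h1.1, h1.2, h3.1, h3.2]
    linarith

/-- A minimizer of the criterion is nearly optimal for the loss. -/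
theorem abs_loss_ratio_sub_one_le (hδ : 0 < δ) (hb : ∀ m, 0 ≤ b m) (hk : ∀ m, 0 < k m)
    (hη : 0 ≤ η) (ha : ∀ m, |a m| ≤ η * (b m + k m)) (hq : ∀ m, |q m - k m| ≤ η * (b m + k m))
    (hηδ : 16 * η ≤ δ ^ 2) (hw : w ∈ weightSet M N δ)
    (hmin : IsMinOn (nestedCriterion a b q k s) (weightSet M N δ) w) :
    |nestedLoss a b q w / sInf (nestedLoss a b q '' weightSet M N δ) - 1| ≤ 32 * η / δ ^ 2 := by
  set κ := 4 * η / δ ^ 2 with hκ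
  have hκ0 : 0 ≤ κ := by positivity
  have hκ1 : κ ≤ 1 / 4 := by
    rw [hκ, div_le_iff₀ (by positivity)]; linarith
  have key : ∀ v ∈ weightSet M N δ, 0 < nestedLoss a b q v ∧
      |nestedCriterion a b q k s v - s - nestedLoss a b q v| ≤ 2 * κ * nestedLoss a b q v := by
    intro v hv
    obtain ⟨R, hR, h1, h2⟩ := exists_risk_bounds (s := s) hδ hb hk hη ha hq hv
    have h3 : R - κ * R ≤ nestedLoss a b q v := by linarith [(abs_le.1 h1).1]
    have h4 : κ * R ≤ 1 / 4 * R := mul_le_mul_of_nonneg_right hκ1 hR.le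
    have h5 : R ≤ 2 * nestedLoss a b q v := by linarith
    refine ⟨by linarith, h2.trans ?_⟩
    have := mul_le_mul_of_nonneg_left h5 hκ0
    linarith
  have hle : ∀ v ∈ weightSet M N δ, nestedLoss a b q w ≤ (1 + 8 * κ) * nestedLoss a b q v := by
    intro v hv
    obtain ⟨hw0, hw1⟩ := key w hw
    obtain ⟨hv0, hv1⟩ := key v hv
    have hc : nestedCriterion a b q k s w ≤ nestedCriterion a b q k s v := hmin hv
    have h1 := (abs_le.1 hw1).1
    have h2 := (abs_le.1 hv1).2
    have h3 : (1 - 2 * κ) * nestedLoss a b q w ≤ (1 + 2 * κ) * nestedLoss a b q v := by linarith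
    have h4 : (1 + 2 * κ) * nestedLoss a b q v ≤
        (1 - 2 * κ) * ((1 + 8 * κ) * nestedLoss a b q v) := by
      -- The product is `1 + 6 κ - 16 κ²`, so this is exactly the condition `κ ≤ 1 / 4`.
      have : 1 + 2 * κ ≤ (1 - 2 * κ) * (1 + 8 * κ) := by nlinarith
      have := mul_le_mul_of_nonneg_right this hv0.le
      linarith
    exact le_of_mul_le_mul_left (h3.trans h4) (by linarith)
  obtain ⟨hw0, -⟩ := key w hw
  have hbdd : BddBelow (nestedLoss a b q '' weightSet M N δ) :=
    ⟨0, by rintro _ ⟨v, hv, rfl⟩; exact (key v hv).1.le⟩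
  have hI1 : sInf (nestedLoss a b q '' weightSet M N δ) ≤ nestedLoss a b q w :=
    csInf_le hbdd ⟨w, hw, rfl⟩
  have hI2 : nestedLoss a b q w / (1 + 8 * κ) ≤ sInf (nestedLoss a b q '' weightSet M N δ) := by
    refine le_csInf ⟨_, w, hw, rfl⟩ ?_
    rintro _ ⟨v, hv, rfl⟩
    rw [div_le_iff₀ (by positivity), mul_comm]
    exact hle v hv
  have hI0 : 0 < sInf (nestedLoss a b q '' weightSet M N δ) :=
    lt_of_lt_of_le (by positivity) hI2
  rw [abs_of_nonneg (sub_nonneg.2 ((one_le_div hI0).2 hI1)), sub_le_iff_le_add, div_le_iff₀ hI0]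
  rw [div_le_iff₀ (by positivity)] at hI2
  have : 32 * η / δ ^ 2 = 8 * κ := by rw [hκ]; ring
  rw [this]
  linarith

end Weights

/-! ### Nested projections -/

section Projections

variable {E : Type*} [AddCommGroup E] [Module ℝ E] {M : ℕ} {f : LinearMap.BilinForm ℝ E}
  {H : Fin M → E →ₗ[ℝ] E}

/-- A chain of projections, orthogonal for a positive semidefinite form. -/
structure IsNestedProj (f : LinearMap.BilinForm ℝ E) (H : Fin M → E →ₗ[ℝ] E) : Prop where
  symm : ∀ x y, f x y = f y x
  nonneg : ∀ x, 0 ≤ f x x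
  adj : ∀ m x y, f (H m x) y = f x (H m y)
  comp : ∀ m l x, H m (H l x) = H (min m l) x

lemma bilin_sum_smul (w : Fin M → ℝ) (u : Fin M → E) :
    f (∑ m, w m • u m) (∑ m, w m • u m) = pairSum w fun m l => f (u m) (u l) := by
  simp only [pairSum, map_sum, LinearMap.sum_apply, map_smul, LinearMap.smul_apply, smul_eq_mul,
    Finset.mul_sum]
  rw [Finset.sum_comm]
  exact Finset.sum_congr rfl fun m _ => Finset.sum_congr rfl fun l _ => by ring

lemma IsNestedProj.sq_eq (h : IsNestedProj f H) (m : Fin M) (x : E) :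
    f (x - H m x) (x - H m x) = f x (x - H m x) := by
  simp only [map_sub, LinearMap.sub_apply, h.adj, h.comp, min_self]
  ring

lemma IsNestedProj.bias_nonneg (h : IsNestedProj f H) (m : Fin M) (x : E) :
    0 ≤ f x (x - H m x) := by
  rw [← h.sq_eq]
  exact h.nonneg _

/-- The difference of the energies is the squared length of `H l x - H m x`. -/
lemma IsNestedProj.energy_mono (h : IsNestedProj f H) (x : E) {m l : Fin M} (hml : m ≤ l) :
    f x (H m x) ≤ f x (H l x) := by
  have h1 := h.nonneg (H l x - H m x)
  simp only [map_sub, LinearMap.sub_apply, h.adj, h.comp, min_self, min_eq_left hml,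
    min_eq_right hml] at h1
  linarith

/-- As the weights sum to one, the error is the average of `H m y - (x - H m x)`. Products of
residuals collapse to the larger model, products of projections to the smaller one, and mixed
products leave a difference of cross terms. -/
lemma IsNestedProj.loss_eq (h : IsNestedProj f H) (x y : E) {w : Fin M → ℝ} (hw : ∑ m, w m = 1) :
    f ((∑ m, w m • H m (x + y)) - x) ((∑ m, w m • H m (x + y)) - x) =
      nestedLoss (fun m => f (x - H m x) y) (fun m => f x (x - H m x)) (fun m => f y (H m y)) w := by
  have e1 : (∑ m, w m • H m (x + y)) - x = ∑ m, w m • (H m (x + y) - x) := by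
    simp only [smul_sub, Finset.sum_sub_distrib, ← Finset.sum_smul, hw, one_smul]
  have hxy : ∀ m, f y (H m x) = f x (H m y) := fun m => by rw [← h.adj, h.symm]
  rw [e1, bilin_sum_smul, nestedLoss]
  congr 1
  ext m l
  rcases le_total m l with hml | hml
  · simp only [map_sub, map_add, LinearMap.sub_apply, LinearMap.add_apply, h.adj, h.comp,
      min_eq_left hml, max_eq_right hml, hxy]
    ring
  · simp only [map_sub, map_add, LinearMap.sub_apply, LinearMap.add_apply, h.adj, h.comp,
      min_eq_right hml, max_eq_left hml, hxy]
    ring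

lemma IsNestedProj.criterion_eq (h : IsNestedProj f H) (x y : E) {w : Fin M → ℝ}
    (hw : ∑ m, w m = 1) (k : Fin M → ℝ) :
    f (x + y - ∑ m, w m • H m (x + y)) (x + y - ∑ m, w m • H m (x + y)) + 2 * ∑ m, w m * k m =
      nestedCriterion (fun m => f (x - H m x) y) (fun m => f x (x - H m x))
        (fun m => f y (H m y)) k (f y y) w := by
  have e1 : x + y - ∑ m, w m • H m (x + y) = ∑ m, w m • (x + y - H m (x + y)) := by
    simp only [smul_sub, Finset.sum_sub_distrib, ← Finset.sum_smul, hw, one_smul]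
  have hxy : ∀ m, f y (H m x) = f x (H m y) := fun m => by rw [← h.adj, h.symm]
  rw [e1, bilin_sum_smul, nestedCriterion]
  congr 2
  ext m l
  rcases le_total m l with hml | hml
  · simp only [map_sub, map_add, LinearMap.sub_apply, LinearMap.add_apply, h.adj, h.comp,
      min_eq_left hml, max_eq_right hml, hxy, h.symm y x]
    ring
  · simp only [map_sub, map_add, LinearMap.sub_apply, LinearMap.add_apply, h.adj, h.comp,
      min_eq_right hml, max_eq_left hml, hxy, h.symm y x]
    ring

end Projections

/-! ### Generalized least squares projections -/

section GLS

lemma mulVec_injective_of_rank_eq {n K : ℕ} {X : Matrix (Fin n) (Fin K) ℝ} (hX : X.rank = K) :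
    Function.Injective X.mulVec := by
  have h := X.mulVecLin.finrank_range_add_finrank_ker
  rw [Module.finrank_fin_fun] at h
  have h0 : Module.finrank ℝ (LinearMap.ker X.mulVecLin) = 0 := by
    rw [Matrix.rank] at hX; omega
  exact LinearMap.ker_eq_bot.1 (Submodule.finrank_eq_zero.1 h0)

variable {n K : ℕ} {V : Matrix (Fin n) (Fin n) ℝ} {X : Matrix (Fin n) (Fin K) ℝ}

lemma isUnit_gram_det (hV : V.PosDef) (hX : X.rank = K) : IsUnit (Xᵀ * V⁻¹ * X).det := by
  have := hV.inv.conjTranspose_mul_mul_same (mulVec_injective_of_rank_eq hX)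
  rw [Matrix.conjTranspose_eq_transpose_of_trivial] at this
  exact this.isUnit.map Matrix.detMonoidHom

lemma transpose_inv_of_posDef (hV : V.PosDef) : (V⁻¹)ᵀ = V⁻¹ := by
  have := hV.inv.isHermitian.eq
  rwa [Matrix.conjTranspose_eq_transpose_of_trivial] at this

/-- Symmetry of this product is self-adjointness of the hat matrix for the form `V⁻¹`. -/
lemma inv_mul_glsHat_symm (hV : V.PosDef) : (V⁻¹ * glsHat V X)ᵀ = V⁻¹ * glsHat V X := by
  have h := transpose_inv_of_posDef hV
  have h2 : ((Xᵀ * V⁻¹ * X)⁻¹)ᵀ = (Xᵀ * V⁻¹ * X)⁻¹ := by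
    rw [Matrix.transpose_nonsing_inv]
    simp [Matrix.transpose_mul, h, Matrix.mul_assoc]
  have h3 : V⁻¹ * glsHat V X = V⁻¹ * X * (Xᵀ * V⁻¹ * X)⁻¹ * (V⁻¹ * X)ᵀ := by
    rw [Matrix.transpose_mul, h]
    simp only [glsHat, Matrix.mul_assoc]
  generalize (Xᵀ * V⁻¹ * X)⁻¹ = G at h2 h3
  rw [h3]
  simp only [Matrix.transpose_mul, h2, Matrix.transpose_transpose, Matrix.mul_assoc]

lemma glsHat_mul_design (hV : V.PosDef) (hX : X.rank = K) : glsHat V X * X = X := by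
  have := Matrix.nonsing_inv_mul _ (isUnit_gram_det hV hX)
  calc glsHat V X * X = X * ((Xᵀ * V⁻¹ * X)⁻¹ * (Xᵀ * V⁻¹ * X)) := by
        simp only [glsHat, Matrix.mul_assoc]
    _ = X := by rw [this, Matrix.mul_one]

lemma trace_glsHat (hV : V.PosDef) (hX : X.rank = K) : (glsHat V X).trace = K := by
  have := Matrix.nonsing_inv_mul _ (isUnit_gram_det hV hX)
  have e : glsHat V X = X * ((Xᵀ * V⁻¹ * X)⁻¹ * (Xᵀ * V⁻¹)) := by
    simp only [glsHat, Matrix.mul_assoc]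
  rw [e, Matrix.trace_mul_comm, Matrix.mul_assoc, this]
  simp

/-- The square roots only occur in pairs that multiply to `V⁻¹`; from here on the argument is free
of them. -/
lemma modelRisk_eq (hV : V.PosDef) (x : ℕ → ℕ → ℝ) (μ : Fin n → ℝ) (K : ℕ) :
    modelRisk V x μ K = μ ⬝ᵥ (V⁻¹ *ᵥ (μ - glsHat V (design x n K) *ᵥ μ)) + K := by
  have hs : invSqrt V * invSqrt V = V⁻¹ :=
    CFC.sqrt_mul_sqrt_self _ hV.inv.posSemidef.nonneg
  have e : invSqrt V * (1 - proj V (design x n K)) * invSqrt V =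
      V⁻¹ * (1 - glsHat V (design x n K)) := by
    rw [mul_sub, sub_mul, mul_sub, mul_one, mul_one, hs, proj, glsHat]
    congr 1
    simp only [← Matrix.mul_assoc, hs]
    simp only [Matrix.mul_assoc, hs]
  rw [modelRisk, e, ← Matrix.mulVec_mulVec, Matrix.sub_mulVec, Matrix.one_mulVec]

lemma design_castLE (x : ℕ → ℕ → ℝ) {K L : ℕ} (h : K ≤ L) :
    design x n K = design x n L * (1 : Matrix (Fin L) (Fin L) ℝ).submatrix id (Fin.castLE h) := by
  ext i j
  simp [design, Matrix.mul_apply, Matrix.one_apply]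

lemma glsHat_mul_of_le (hV : V.PosDef) (x : ℕ → ℕ → ℝ) {K L : ℕ} (h : K ≤ L)
    (hL : (design x n L).rank = L) :
    glsHat V (design x n L) * glsHat V (design x n K) = glsHat V (design x n K) := by
  have e : glsHat V (design x n L) * design x n K = design x n K := by
    rw [design_castLE x h, ← Matrix.mul_assoc, glsHat_mul_design hV hL]
  conv_lhs => enter [2]; rw [glsHat]
  simp only [← Matrix.mul_assoc, e]
  rfl

/-- The adjoint of `glsHat_mul_of_le` with respect to the form `V⁻¹`. -/
lemma glsHat_mul_of_ge (hV : V.PosDef) (x : ℕ → ℕ → ℝ) {K L : ℕ} (h : K ≤ L)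
    (hL : (design x n L).rank = L) :
    glsHat V (design x n K) * glsHat V (design x n L) = glsHat V (design x n K) := by
  have hVu : IsUnit V.det := hV.isUnit.map Matrix.detMonoidHom
  have h1 := inv_mul_glsHat_symm (X := design x n K) hV
  have h2 := inv_mul_glsHat_symm (X := design x n L) hV
  have h3 := congrArg (fun A => V⁻¹ * A) (glsHat_mul_of_le hV x h hL)
  have h4 : V⁻¹ * (glsHat V (design x n K) * glsHat V (design x n L)) =
      V⁻¹ * glsHat V (design x n K) := by
    have hW := transpose_inv_of_posDef hV
    rw [← Matrix.mul_assoc, ← h1, Matrix.transpose_mul, hW, Matrix.mul_assoc, ← h2,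
      Matrix.transpose_mul, hW, ← Matrix.mul_assoc, ← Matrix.transpose_mul,
      glsHat_mul_of_le hV x h hL]
  have h5 := congrArg (fun A => V * A) h4
  simpa only [← Matrix.mul_assoc, Matrix.mul_nonsing_inv _ hVu, Matrix.one_mul] using h5

lemma glsHat_isNestedProj (hV : V.PosDef) (x : ℕ → ℕ → ℝ) {M : ℕ} {k : Fin M → ℕ} (hk : Monotone k)
    (hX : ∀ m, (design x n (k m)).rank = k m) :
    IsNestedProj (Matrix.toBilin' V⁻¹) fun m => (glsHat V (design x n (k m))).mulVecLin := by
  have hW := transpose_inv_of_posDef hV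
  refine ⟨fun u v => ?_, fun u => ?_, fun m u v => ?_, fun m l u => ?_⟩
  · rw [Matrix.toBilin'_apply', Matrix.toBilin'_apply', Matrix.dotProduct_mulVec,
      ← Matrix.mulVec_transpose, hW, dotProduct_comm]
  · have := hV.inv.posSemidef.dotProduct_mulVec_nonneg u
    simpa [Matrix.toBilin'_apply'] using this
  · have h1 := inv_mul_glsHat_symm (X := design x n (k m)) hV
    simp only [Matrix.toBilin'_apply', Matrix.mulVecLin_apply, Matrix.mulVec_mulVec]
    conv_rhs => rw [← h1, Matrix.transpose_mul, hW, ← Matrix.mulVec_mulVec,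
      Matrix.dotProduct_mulVec, Matrix.vecMul_transpose]
  · simp only [Matrix.mulVecLin_apply, Matrix.mulVec_mulVec]
    rcases le_total m l with h | h
    · rw [min_eq_left h, glsHat_mul_of_ge hV x (hk h) (hX l)]
    · rw [min_eq_right h, glsHat_mul_of_le hV x (hk h) (hX m)]

/-- The squared bias of the model with `K` regressors. -/
noncomputable def biasTerm (V : Matrix (Fin n) (Fin n) ℝ) (x : ℕ → ℕ → ℝ) (μ : Fin n → ℝ) (K : ℕ) :
    ℝ := μ ⬝ᵥ (V⁻¹ *ᵥ (μ - glsHat V (design x n K) *ᵥ μ))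

/-- The cross term of the bias with the errors `u`. -/
noncomputable def crossTerm (V : Matrix (Fin n) (Fin n) ℝ) (x : ℕ → ℕ → ℝ) (μ u : Fin n → ℝ)
    (K : ℕ) : ℝ := (V⁻¹ *ᵥ (μ - glsHat V (design x n K) *ᵥ μ)) ⬝ᵥ u

/-- The energy of the projection of the errors `u`. -/
noncomputable def noiseTerm (V : Matrix (Fin n) (Fin n) ℝ) (x : ℕ → ℕ → ℝ) (u : Fin n → ℝ) (K : ℕ) :
    ℝ := u ⬝ᵥ ((V⁻¹ * glsHat V (design x n K)) *ᵥ u)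

/-! ### Loss and criterion as nested quadratic forms -/

section Nested

variable {M : ℕ} {k : Fin M → ℕ}

lemma toBilin_cross (hV : V.PosDef) (u v : Fin n → ℝ) :
    Matrix.toBilin' V⁻¹ u v = (V⁻¹ *ᵥ u) ⬝ᵥ v := by
  rw [Matrix.toBilin'_apply', Matrix.dotProduct_mulVec, ← Matrix.mulVec_transpose,
    transpose_inv_of_posDef hV]

lemma avgEstimator_eq (x : ℕ → ℕ → ℝ) (Y : Fin n → ℝ) (w : Fin M → ℝ) :
    avgEstimator V x k Y w = ∑ m, w m • (glsHat V (design x n (k m))).mulVecLin Y := by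
  simp [avgEstimator, Matrix.sum_mulVec, Matrix.smul_mulVec]

lemma loss_eq_nestedLoss (hV : V.PosDef) (x : ℕ → ℕ → ℝ) (hk : Monotone k)
    (hX : ∀ m, (design x n (k m)).rank = k m) (μ u : Fin n → ℝ) {w : Fin M → ℝ}
    (hw : ∑ m, w m = 1) :
    loss V x k μ (fun i => μ i + u i) w =
      nestedLoss (fun m => crossTerm V x μ u (k m)) (fun m => biasTerm V x μ (k m))
        (fun m => noiseTerm V x u (k m)) w := by
  have h := (glsHat_isNestedProj hV x hk hX).loss_eq μ u hw
  simp only [Matrix.toBilin'_apply'] at h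
  rw [loss, avgEstimator_eq]
  refine h.trans ?_
  simp only [← Matrix.toBilin'_apply', crossTerm, biasTerm, noiseTerm, ← toBilin_cross hV,
    Matrix.mulVecLin_apply, ← Matrix.mulVec_mulVec]

lemma criterion_eq_nestedCriterion (hV : V.PosDef) (x : ℕ → ℕ → ℝ) (hk : Monotone k)
    (hX : ∀ m, (design x n (k m)).rank = k m) (μ u : Fin n → ℝ) {w : Fin M → ℝ}
    (hw : ∑ m, w m = 1) :
    criterion V x k (fun i => μ i + u i) w =
      nestedCriterion (fun m => crossTerm V x μ u (k m)) (fun m => biasTerm V x μ (k m))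
        (fun m => noiseTerm V x u (k m)) (fun m => (k m : ℝ)) (Matrix.toBilin' V⁻¹ u u) w := by
  have h := (glsHat_isNestedProj hV x hk hX).criterion_eq μ u hw fun m => (k m : ℝ)
  rw [criterion, avgEstimator_eq]
  simp only [← Matrix.toBilin'_apply']
  refine h.trans ?_
  simp only [crossTerm, biasTerm, noiseTerm, ← toBilin_cross hV, ← Matrix.toBilin'_apply',
    Matrix.mulVecLin_apply, ← Matrix.mulVec_mulVec]

lemma biasTerm_nonneg (hV : V.PosDef) (x : ℕ → ℕ → ℝ) (μ : Fin n → ℝ) {K : ℕ}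
    (hX : (design x n K).rank = K) : 0 ≤ biasTerm V x μ K := by
  have h := (glsHat_isNestedProj (M := 1) (k := fun _ => K) hV x monotone_const
    fun _ => hX).bias_nonneg 0 μ
  simpa [biasTerm, Matrix.toBilin'_apply'] using h

lemma noiseTerm_mono (hV : V.PosDef) (x : ℕ → ℕ → ℝ) (u : Fin n → ℝ) (hk : Monotone k)
    (hX : ∀ m, (design x n (k m)).rank = k m) {m l : Fin M} (hml : m ≤ l) :
    noiseTerm V x u (k m) ≤ noiseTerm V x u (k l) := by
  have h := (glsHat_isNestedProj hV x hk hX).energy_mono u hml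
  simpa [noiseTerm, Matrix.toBilin'_apply', Matrix.mulVec_mulVec] using h

/-- Near optimality of the minimizer of the criterion, for given regressors and errors. -/
theorem abs_loss_ratio_le (hV : V.PosDef) (x : ℕ → ℕ → ℝ) (hk : Monotone k)
    (hk1 : ∀ m, 1 ≤ k m) (hX : ∀ m, (design x n (k m)).rank = k m) (μ u : Fin n → ℝ)
    {N : ℕ} {δ η : ℝ} (hδ : 0 < δ) (hη : 0 ≤ η) (hηδ : 16 * η ≤ δ ^ 2)
    (ha : ∀ m, |crossTerm V x μ u (k m)| ≤ η * modelRisk V x μ (k m))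
    (hq : ∀ m, |noiseTerm V x u (k m) - k m| ≤ η * modelRisk V x μ (k m)) {w : Fin M → ℝ}
    (hw : w ∈ weightSet M N δ)
    (hmin : IsMinOn (criterion V x k (fun i => μ i + u i)) (weightSet M N δ) w) :
    |loss V x k μ (fun i => μ i + u i) w /
        sInf (loss V x k μ (fun i => μ i + u i) '' weightSet M N δ) - 1| ≤ 32 * η / δ ^ 2 := by
  have hr : ∀ m, modelRisk V x μ (k m) = biasTerm V x μ (k m) + k m := fun m =>
    modelRisk_eq hV x μ (k m)
  simp only [hr] at ha hq
  have hl : ∀ v ∈ weightSet M N δ, loss V x k μ (fun i => μ i + u i) v = _ := fun v hv =>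
    loss_eq_nestedLoss hV x hk hX μ u (weightSet_sum hv)
  have hc : ∀ v ∈ weightSet M N δ, criterion V x k (fun i => μ i + u i) v = _ := fun v hv =>
    criterion_eq_nestedCriterion hV x hk hX μ u (weightSet_sum hv)
  rw [hl w hw, Set.image_congr hl]
  refine abs_loss_ratio_sub_one_le (k := fun m => (k m : ℝ)) (s := Matrix.toBilin' V⁻¹ u u) hδ
    (fun m => biasTerm_nonneg hV x μ (hX m)) (fun m => by exact_mod_cast hk1 m) hη ha hq hηδ hw ?_
  intro v hv
  have h : criterion V x k (fun i => μ i + u i) w ≤ criterion V x k (fun i => μ i + u i) v :=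
    hmin hv
  rw [hc w hw, hc v hv] at h
  exact h

end Nested

end GLS

/-! ### Moments of the cross and noise terms for given regressors -/

section Conditional

variable {Ω : Type*} [mΩ : MeasurableSpace Ω] {P : Measure Ω} [IsProbabilityMeasure P]
variable {ℱ : Filtration ℤ mΩ} {α : ℤ → Ω → ℝ} {σ τ S : ℝ} {β : ℕ → ℝ} {e : ℤ → Ω → ℝ}

lemma HasNonvanishingSpectrum.sigma_ne_zero (h : HasNonvanishingSpectrum β σ) : σ ≠ 0 := by
  rintro rfl
  exact h.ne_zero 0 (by linarith [Real.pi_pos]) Real.pi_pos.le (by simp [spectralDensity])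

/-- Fourth moments follow from `z ^ 4 ≤ 1 + |z| ^ S` for `4 ≤ S`, integrated against the conditional
moment bound. -/
lemma IsLinearErrorProcess.isHomoscedasticMDS (h : IsLinearErrorProcess P e ℱ α β σ S)
    (hS : 4 ≤ S) : ∃ τ, IsHomoscedasticMDS P ℱ α σ τ := by
  obtain ⟨C, -, hC⟩ := h.condMoment
  have hle : ∀ t ω, (α t ω) ^ 4 ≤ 1 + |α t ω| ^ S := by
    intro t ω
    have h0 := abs_nonneg (α t ω)
    have h4 : (α t ω) ^ 4 = |α t ω| ^ 4 := by rw [Even.pow_abs ⟨2, rfl⟩]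
    rw [h4]
    rcases le_total (|α t ω|) 1 with h1 | h1
    · have := pow_le_one₀ h0 h1 (n := 4)
      have := Real.rpow_nonneg h0 S
      linarith
    · have h5 : |α t ω| ^ (4 : ℝ) = |α t ω| ^ 4 := by exact_mod_cast Real.rpow_natCast _ 4
      rw [← h5]
      exact (Real.rpow_le_rpow_of_exponent_le h1 hS).trans (by linarith)
  have hm : ∀ t, Measurable (α t) := fun t => (h.adapted t).mono (ℱ.le t) le_rfl
  have hint : ∀ t, Integrable (fun ω => (α t ω) ^ 4) P := fun t =>
    ((integrable_const (1 : ℝ)).add (h.integrable_moment t)).mono'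
      ((hm t).pow_const 4).aestronglyMeasurable (ae_of_all _ fun ω => by
        rw [Real.norm_eq_abs, abs_of_nonneg (by positivity)]
        exact hle t ω)
  refine ⟨1 + C, h.adapted, fun t => ?_, h.condMean, h.condVar, fun t => ?_⟩
  · rw [← integrable_norm_rpow_iff (hm t).aestronglyMeasurable (by simp) (by simp)]
    refine (hint t).congr (ae_of_all _ fun ω => ?_)
    have h4 : |α t ω| ^ (4 : ℝ) = |α t ω| ^ 4 := by exact_mod_cast Real.rpow_natCast _ 4
    simp only [Real.norm_eq_abs, ENNReal.toReal_ofNat, h4]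
    rw [Even.pow_abs ⟨2, rfl⟩]
  · calc ∫ ω, (α t ω) ^ 4 ∂P ≤ ∫ ω, (1 + |α t ω| ^ S) ∂P :=
          integral_mono (hint t) ((integrable_const _).add (h.integrable_moment t)) (hle t)
      _ = 1 + ∫ ω, |α t ω| ^ S ∂P := by
          rw [integral_add (integrable_const _) (h.integrable_moment t)]
          simp
      _ ≤ 1 + C := by
          have h1 : ∫ ω, |α t ω| ^ S ∂P ≤ ∫ _, C ∂P := by
            rw [← integral_condExp (ℱ.le (t - 1))]
            exact integral_mono_ae integrable_condExp (integrable_const _) (hC t)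
          simpa using h1

/-- The rank-one matrix `B = c cᵀ` turns the square of the linear form into a quadratic form with
mean `r = cᵀ Σ c`; then `z⁴ ≤ 2 r² + 2 (z² - r)²`. -/
lemma IsHomoscedasticMDS.lintegral_dotProduct_pow_four_le (h : IsHomoscedasticMDS P ℱ α σ τ)
    (hβ : Summable fun k => |β k|) (hσ : σ ≠ 0)
    (he : ∀ t, ∀ᵐ ω ∂P, HasSum (fun k : ℕ => β k * α (t - k) ω) (e t ω)) {n : ℕ}
    (c : Fin n → ℝ) :
    ∫⁻ ω, ENNReal.ofReal ((c ⬝ᵥ fun i : Fin n => e ((i : ℕ) + 1) ω) ^ 4) ∂P ≤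
      ENNReal.ofReal (2 * ((2 * τ + 8 * σ ^ 4) / σ ^ 4 + 1) * (c ⬝ᵥ (errCov P e n *ᵥ c)) ^ 2) := by
  have hτ := h.tau_nonneg
  have hB : (Matrix.vecMulVec c c)ᵀ = Matrix.vecMulVec c c := by
    ext i j
    simp [Matrix.vecMulVec_apply, mul_comm]
  have key := h.lintegral_quadratic_errors_le hβ hσ he (Matrix.vecMulVec c c) hB
  have e1 : (Matrix.vecMulVec c c * errCov P e n).trace = c ⬝ᵥ (errCov P e n *ᵥ c) := by
    rw [Matrix.trace_mul_comm, Matrix.mul_vecMulVec, Matrix.trace_vecMulVec, dotProduct_comm]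
  have e2 : (Matrix.vecMulVec c c * errCov P e n * (Matrix.vecMulVec c c * errCov P e n)).trace =
      (c ⬝ᵥ (errCov P e n *ᵥ c)) ^ 2 := by
    rw [Matrix.vecMulVec_mul, Matrix.vecMulVec_mul_vecMulVec, Matrix.trace_vecMulVec,
      dotProduct_smul, ← Matrix.dotProduct_mulVec, dotProduct_comm c (c ᵥ* _),
      ← Matrix.dotProduct_mulVec, smul_eq_mul, sq]
  have e3 : ∀ v : Fin n → ℝ, v ⬝ᵥ (Matrix.vecMulVec c c *ᵥ v) = (c ⬝ᵥ v) ^ 2 := by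
    intro v
    rw [Matrix.vecMulVec_mulVec, sq]
    simp [dotProduct_smul, dotProduct_comm v c]
  simp_rw [e1, e2, e3] at key
  set r := c ⬝ᵥ (errCov P e n *ᵥ c) with hr
  calc ∫⁻ ω, ENNReal.ofReal ((c ⬝ᵥ fun i : Fin n => e ((i : ℕ) + 1) ω) ^ 4) ∂P
      ≤ ∫⁻ ω, (ENNReal.ofReal (2 * r ^ 2) + 2 * ENNReal.ofReal
          (((c ⬝ᵥ fun i : Fin n => e ((i : ℕ) + 1) ω) ^ 2 - r) ^ 2)) ∂P := by
        refine lintegral_mono fun ω => ?_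
        rw [← ENNReal.ofReal_ofNat, ← ENNReal.ofReal_mul (by norm_num),
          ← ENNReal.ofReal_add (by positivity) (by positivity)]
        refine ENNReal.ofReal_le_ofReal ?_
        nlinarith [sq_nonneg ((c ⬝ᵥ fun i : Fin n => e ((i : ℕ) + 1) ω) ^ 2 - 2 * r)]
    _ ≤ ENNReal.ofReal (2 * r ^ 2) + 2 * ENNReal.ofReal ((2 * τ + 8 * σ ^ 4) / σ ^ 4 * r ^ 2) := by
        rw [lintegral_add_left measurable_const, lintegral_const, measure_univ, mul_one,
          lintegral_const_mul' _ _ (by simp)]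
        gcongr
    _ = _ := by
        rw [← ENNReal.ofReal_ofNat, ← ENNReal.ofReal_mul (by norm_num),
          ← ENNReal.ofReal_add (by positivity) (by positivity)]
        congr 1
        ring

variable {n : ℕ} {K : ℕ} {x : ℕ → ℕ → ℝ}

/-- Here `B Σ = Σ⁻¹ H Σ` is idempotent of trace `K`, so `tr (B Σ)`, the mean, and `tr (B Σ B Σ)`,
the variance factor, are both `K`. -/
lemma IsHomoscedasticMDS.lintegral_noiseTerm_le (h : IsHomoscedasticMDS P ℱ α σ τ)
    (hβ : Summable fun k => |β k|) (hσ : σ ≠ 0)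
    (he : ∀ t, ∀ᵐ ω ∂P, HasSum (fun k : ℕ => β k * α (t - k) ω) (e t ω))
    (hV : (errCov P e n).PosDef) (hX : (design x n K).rank = K) :
    ∫⁻ ω, ENNReal.ofReal ((noiseTerm (errCov P e n) x (fun i => e ((i : ℕ) + 1) ω) K - K) ^ 2) ∂P ≤
      ENNReal.ofReal ((2 * τ + 8 * σ ^ 4) / σ ^ 4 * K) := by
  have hVu : IsUnit (errCov P e n).det := hV.isUnit.map Matrix.detMonoidHom
  have key := h.lintegral_quadratic_errors_le hβ hσ he
    ((errCov P e n)⁻¹ * glsHat (errCov P e n) (design x n K)) (inv_mul_glsHat_symm hV)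
  set V := errCov P e n
  set H := glsHat V (design x n K)
  have e1 : (V⁻¹ * H * V).trace = K := by
    rw [Matrix.trace_mul_comm, ← Matrix.mul_assoc, Matrix.mul_nonsing_inv _ hVu, Matrix.one_mul,
      trace_glsHat hV hX]
  have e2 : (V⁻¹ * H * V * (V⁻¹ * H * V)).trace = K := by
    have : V⁻¹ * H * V * (V⁻¹ * H * V) = V⁻¹ * H * V := by
      calc V⁻¹ * H * V * (V⁻¹ * H * V) = V⁻¹ * H * (V * V⁻¹) * H * V := by
            simp only [Matrix.mul_assoc]
        _ = V⁻¹ * (H * H) * V := by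
            rw [Matrix.mul_nonsing_inv _ hVu, Matrix.mul_one, Matrix.mul_assoc V⁻¹]
        _ = _ := by rw [glsHat_mul_of_le hV x le_rfl hX]
    rw [this, e1]
  rw [e1, e2] at key
  exact key

/-- Identifies the variance of the cross term with the squared bias. -/
lemma dotProduct_residual_eq {V : Matrix (Fin n) (Fin n) ℝ} (hV : V.PosDef)
    (hX : (design x n K).rank = K) (μ : Fin n → ℝ) :
    (V⁻¹ *ᵥ (μ - glsHat V (design x n K) *ᵥ μ)) ⬝ᵥ
      (V *ᵥ (V⁻¹ *ᵥ (μ - glsHat V (design x n K) *ᵥ μ))) = biasTerm V x μ K := by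
  have hVu : IsUnit V.det := hV.isUnit.map Matrix.detMonoidHom
  have h := (glsHat_isNestedProj (M := 1) (k := fun _ => K) hV x monotone_const
    fun _ => hX).sq_eq 0 μ
  rw [Matrix.mulVec_mulVec, Matrix.mul_nonsing_inv _ hVu, Matrix.one_mulVec, ← toBilin_cross hV]
  simpa [biasTerm, Matrix.toBilin'_apply'] using h

lemma IsHomoscedasticMDS.lintegral_crossTerm_le (h : IsHomoscedasticMDS P ℱ α σ τ)
    (hβ : Summable fun k => |β k|) (hσ : σ ≠ 0)
    (he : ∀ t, ∀ᵐ ω ∂P, HasSum (fun k : ℕ => β k * α (t - k) ω) (e t ω))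
    (hV : (errCov P e n).PosDef) (hX : (design x n K).rank = K) (μ : Fin n → ℝ) :
    ∫⁻ ω, ENNReal.ofReal ((crossTerm (errCov P e n) x μ (fun i => e ((i : ℕ) + 1) ω) K) ^ 4) ∂P ≤
      ENNReal.ofReal (2 * ((2 * τ + 8 * σ ^ 4) / σ ^ 4 + 1) *
        (biasTerm (errCov P e n) x μ K) ^ 2) := by
  rw [← dotProduct_residual_eq hV hX]
  exact h.lintegral_dotProduct_pow_four_le hβ hσ he _

end Conditional

/-! ### Measurability in the regressors and the errors -/

section Measurability

variable {𝒳 : Type*} [MeasurableSpace 𝒳] {l m n : Type*}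

lemma measurable_dotProduct [Fintype n] {u v : 𝒳 → n → ℝ} (hu : ∀ i, Measurable fun x => u x i)
    (hv : ∀ i, Measurable fun x => v x i) : Measurable fun x => u x ⬝ᵥ v x :=
  Finset.measurable_sum _ fun i _ => (hu i).mul (hv i)

lemma measurable_mulVec [Fintype n] {A : 𝒳 → Matrix m n ℝ} {v : 𝒳 → n → ℝ}
    (hA : ∀ i j, Measurable fun x => A x i j) (hv : ∀ i, Measurable fun x => v x i) (i : m) :
    Measurable fun x => (A x *ᵥ v x) i :=
  measurable_dotProduct (hA i) hv

lemma measurable_matrix_mul [Fintype m] {A : 𝒳 → Matrix l m ℝ} {B : 𝒳 → Matrix m n ℝ}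
    (hA : ∀ i j, Measurable fun x => A x i j) (hB : ∀ i j, Measurable fun x => B x i j)
    (i : l) (j : n) : Measurable fun x => (A x * B x) i j :=
  measurable_dotProduct (hA i) fun k => hB k j

lemma measurable_det [Fintype n] [DecidableEq n] {A : 𝒳 → Matrix n n ℝ}
    (hA : ∀ i j, Measurable fun x => A x i j) : Measurable fun x => (A x).det := by
  simp_rw [Matrix.det_apply']
  exact Finset.measurable_sum _ fun s _ =>
    (Finset.measurable_prod _ fun i _ => hA _ _).const_mul _

/-- The inverse is the adjugate over the determinant, and real inversion with `0⁻¹ = 0` is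
measurable, so singular matrices need no separate treatment. -/
lemma measurable_matrix_inv [Fintype n] [DecidableEq n] {A : 𝒳 → Matrix n n ℝ}
    (hA : ∀ i j, Measurable fun x => A x i j) (i j : n) : Measurable fun x => (A x)⁻¹ i j := by
  simp_rw [Matrix.inv_def, Ring.inverse_eq_inv', Matrix.smul_apply, smul_eq_mul,
    Matrix.adjugate_apply]
  refine (measurable_det hA).inv.mul (measurable_det fun p q => ?_)
  by_cases hp : p = j
  · subst hp; simp
  · simpa [Matrix.updateRow_apply, hp] using hA p q

variable {n K : ℕ} {V : Matrix (Fin n) (Fin n) ℝ}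

lemma measurable_glsHat (i j : Fin n) :
    Measurable fun x : ℕ → ℕ → ℝ => glsHat V (design x n K) i j := by
  have hx : ∀ i j, Measurable fun x : ℕ → ℕ → ℝ => design x n K i j := fun i j => by
    simp only [design, Matrix.of_apply]
    fun_prop
  have hxt : ∀ i j, Measurable fun x : ℕ → ℕ → ℝ => (design x n K)ᵀ i j := fun i j => hx j i
  have hc : ∀ i j, Measurable fun _ : ℕ → ℕ → ℝ => V⁻¹ i j := fun i j => measurable_const
  exact measurable_matrix_mul (measurable_matrix_mul (measurable_matrix_mul hx
    (measurable_matrix_inv (measurable_matrix_mul (measurable_matrix_mul hxt hc) hx))) hxt) hc i j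

lemma measurable_regMean (θ : ℕ → ℝ) (i : Fin n) :
    Measurable fun x : ℕ → ℕ → ℝ => regMean θ x n i :=
  Measurable.tsum fun j => by fun_prop

lemma measurable_residual (θ : ℕ → ℝ) (i : Fin n) : Measurable fun x : ℕ → ℕ → ℝ =>
    (V⁻¹ *ᵥ (regMean θ x n - glsHat V (design x n K) *ᵥ regMean θ x n)) i := by
  refine measurable_mulVec (A := fun _ => V⁻¹)
    (v := fun x => regMean θ x n - glsHat V (design x n K) *ᵥ regMean θ x n)
    (fun _ _ => measurable_const) (fun j => ?_) i
  exact (measurable_regMean θ j).sub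
    (measurable_mulVec measurable_glsHat (measurable_regMean θ) j)

lemma measurable_modelRisk (hV : V.PosDef) (θ : ℕ → ℝ) :
    Measurable fun x : ℕ → ℕ → ℝ => modelRisk V x (regMean θ x n) K := by
  simp_rw [modelRisk_eq hV]
  exact (measurable_dotProduct (measurable_regMean θ) (measurable_residual θ)).add_const _

lemma measurable_crossTerm (θ : ℕ → ℝ) : Measurable fun p : (ℕ → ℕ → ℝ) × (ℕ → ℝ) =>
    crossTerm V p.1 (regMean θ p.1 n) (fun i => p.2 i) K :=
  measurable_dotProduct (fun i => (measurable_residual θ i).comp measurable_fst)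
    fun i => by fun_prop

lemma measurable_noiseTerm : Measurable fun p : (ℕ → ℕ → ℝ) × (ℕ → ℝ) =>
    noiseTerm V p.1 (fun i : Fin n => p.2 i) K := by
  have hu : ∀ i : Fin n, Measurable fun p : (ℕ → ℕ → ℝ) × (ℕ → ℝ) => p.2 i := fun i => by fun_prop
  have hc : ∀ i j, Measurable fun _ : (ℕ → ℕ → ℝ) × (ℕ → ℝ) => V⁻¹ i j := fun i j =>
    measurable_const
  exact measurable_dotProduct hu (measurable_mulVec (measurable_matrix_mul hc
    fun i j => (measurable_glsHat i j).comp measurable_fst) hu)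

end Measurability

/-! ### Uniform control over the candidate models -/

/-- A majorant, vanishing as `K → ∞`, of sums over models whose risk is at least `K`. -/
noncomputable def gridSum (K : ℝ) : ℝ := ∑' j : ℕ, 1 / max ((j : ℝ) ^ 2) (max K 1)

lemma summable_grid (K : ℝ) : Summable fun j : ℕ => 1 / max ((j : ℝ) ^ 2) (max K 1) := by
  refine (summable_nat_add_iff 1).1 (Summable.of_nonneg_of_le (fun j => by positivity) (fun j => ?_)
    ((summable_nat_add_iff 1).2 (Real.summable_one_div_nat_pow.2 one_lt_two)))
  exact one_div_le_one_div_of_le (by positivity) (le_max_left _ _)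

lemma gridSum_nonneg (K : ℝ) : 0 ≤ gridSum K := tsum_nonneg fun j => by positivity

lemma gridSum_antitone : Antitone gridSum := fun K L h =>
  Summable.tsum_le_tsum (fun j => one_div_le_one_div_of_le (by positivity)
    (max_le_max_left _ (max_le_max_right _ h))) (summable_grid L) (summable_grid K)

lemma tendsto_gridSum : Tendsto gridSum atTop (𝓝 0) := by
  have h := tendsto_tsum_of_dominated_convergence (𝓕 := (atTop : Filter ℝ))
    (f := fun K (j : ℕ) => 1 / max ((j : ℝ) ^ 2) (max K 1)) (g := fun _ => (0 : ℝ))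
    (summable_grid 0) (fun j => ?_) (Eventually.of_forall fun K j => ?_)
  · rwa [tsum_zero] at h
  · refine Tendsto.congr (fun _ => (one_div _).symm) (tendsto_inv_atTop_zero.comp ?_)
    exact tendsto_atTop_mono (fun K => (le_max_left K 1).trans (le_max_right _ _)) tendsto_id
  · rw [Real.norm_of_nonneg (by positivity)]
    exact one_div_le_one_div_of_le (by positivity)
      (max_le_max_left _ (max_le (le_max_of_le_right zero_le_one) (le_max_right _ _)))

lemma one_div_le_gridSum (K : ℝ) : 1 / max K 1 ≤ gridSum K := by
  -- The term `j = 0` is exactly `1 / max K 1`; so a small `gridSum` also forces `K` to be large.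
  have := (summable_grid K).le_tsum 0 fun j _ => by positivity
  refine le_trans (le_of_eq ?_) this
  rw [max_eq_right (a := ((0 : ℕ) : ℝ) ^ 2)]
  simp

lemma sum_le_gridSum {ι : Type*} (S : Finset ι) {f : ι → ℕ} (hf : Set.InjOn f S) (K : ℝ) :
    ∑ m ∈ S, 1 / max ((f m : ℝ) ^ 2) (max K 1) ≤ gridSum K := by
  rw [← Finset.sum_image (f := fun j : ℕ => 1 / max ((j : ℝ) ^ 2) (max K 1)) hf]
  exact (summable_grid K).sum_le_tsum _ fun j _ => by positivity

/-- Every fibre of a map on a finite linear order contains its least element. -/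
lemma exists_fibre_minima {ι : Type*} [Fintype ι] [LinearOrder ι] (f : ι → ℕ) :
    ∃ S : Finset ι, Set.InjOn f S ∧ ∀ m, ∃ l ∈ S, f l = f m ∧ l ≤ m := by
  classical
  refine ⟨Finset.univ.filter fun l => ∀ m, f m = f l → l ≤ m, fun l hl l' hl' h => ?_, fun m => ?_⟩
  · simp only [Finset.coe_filter, Finset.mem_univ, true_and, Set.mem_ofPred_eq] at hl hl'
    exact le_antisymm (hl l' h.symm) (hl' l h)
  · have hne : (Finset.univ.filter fun l => f l = f m).Nonempty := ⟨m, by simp⟩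
    have h1 : f (Finset.min' _ hne) = f m := (Finset.mem_filter.1 (Finset.min'_mem _ hne)).2
    refine ⟨Finset.min' _ hne, ?_, h1, Finset.min'_le _ _ (by simp)⟩
    simp only [Finset.mem_filter, Finset.mem_univ, true_and]
    exact fun l hl => Finset.min'_le _ _ (by simp [hl, h1])

lemma lintegral_ofReal_mul_le {Ω : Type*} [MeasurableSpace Ω] {P : Measure Ω} {f : Ω → ℝ} {b c d : ℝ}
    (hc : 0 ≤ c) (h : ∫⁻ ω, ENNReal.ofReal (f ω) ∂P ≤ ENNReal.ofReal b) (hd : c * b ≤ d) :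
    ∫⁻ ω, ENNReal.ofReal (c * f ω) ∂P ≤ ENNReal.ofReal d := by
  simp_rw [ENNReal.ofReal_mul hc]
  rw [lintegral_const_mul' _ _ ENNReal.ofReal_ne_top]
  refine le_trans ?_ (ENNReal.ofReal_le_ofReal hd)
  rw [ENNReal.ofReal_mul hc]
  gcongr

lemma lintegral_ofReal_sum_le {Ω ι : Type*} [MeasurableSpace Ω] {P : Measure Ω} (S : Finset ι)
    {f : ι → Ω → ℝ} {b : ι → ℝ} (hf : ∀ i ∈ S, Measurable (f i)) (hf0 : ∀ i ∈ S, ∀ ω, 0 ≤ f i ω)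
    (hb : ∀ i ∈ S, 0 ≤ b i)
    (h : ∀ i ∈ S, ∫⁻ ω, ENNReal.ofReal (f i ω) ∂P ≤ ENNReal.ofReal (b i)) :
    ∫⁻ ω, ENNReal.ofReal (∑ i ∈ S, f i ω) ∂P ≤ ENNReal.ofReal (∑ i ∈ S, b i) := by
  have : ∀ ω, ENNReal.ofReal (∑ i ∈ S, f i ω) = ∑ i ∈ S, ENNReal.ofReal (f i ω) := fun ω =>
    ENNReal.ofReal_sum_of_nonneg fun i hi => hf0 i hi ω
  simp_rw [this]
  rw [lintegral_finsetSum _ fun i hi => (hf i hi).ennreal_ofReal, ENNReal.ofReal_sum_of_nonneg hb]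
  exact Finset.sum_le_sum h

/-- Fubini for the product law: it lets the error moments be computed with the regressors held
fixed. -/
lemma lintegral_indep_eq {Ω : Type*} [MeasurableSpace Ω] {P : Measure Ω} [IsFiniteMeasure P]
    {𝒳 𝒴 : Type*} [MeasurableSpace 𝒳] [MeasurableSpace 𝒴]
    {X : Ω → 𝒳} {Y : Ω → 𝒴} (hX : Measurable X) (hY : Measurable Y) (h : IndepFun X Y P)
    {F : 𝒳 × 𝒴 → ENNReal} (hF : Measurable F) :
    ∫⁻ ω, F (X ω, Y ω) ∂P = ∫⁻ ω, ∫⁻ ω', F (X ω, Y ω') ∂P ∂P := by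
  have h1 := (indepFun_iff_map_prod_eq_prod_map_map hX.aemeasurable hY.aemeasurable).1 h
  rw [← lintegral_map (f := F) hF (hX.prodMk hY), h1, lintegral_prod _ hF.aemeasurable,
    lintegral_map hF.lintegral_prod_right' hX]
  refine lintegral_congr fun ω => ?_
  exact lintegral_map (hF.comp measurable_prodMk_left) hY

/-! ### Relative deviations and blocks of dimensions between consecutive squares -/

section Deviation

variable {n M : ℕ}

/-- The minimal risk over the candidate models. -/
noncomputable def minRisk (V : Matrix (Fin n) (Fin n) ℝ) (θ : ℕ → ℝ) (k : Fin M → ℕ)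
    (x : ℕ → ℕ → ℝ) : ℝ := ⨅ m, modelRisk V x (regMean θ x n) (k m)

/-- A lower bound for the risk of the models whose dimension has the same integer square root. -/
noncomputable def blockRisk (V : Matrix (Fin n) (Fin n) ℝ) (θ : ℕ → ℝ) (k : Fin M → ℕ)
    (x : ℕ → ℕ → ℝ) (m : Fin M) : ℝ :=
  max ((Nat.sqrt (k m) : ℝ) ^ 2) (max (minRisk V θ k x) 1)

/-- The squared relative deviation of the noise term of a model. -/
noncomputable def noiseDev (V : Matrix (Fin n) (Fin n) ℝ) (θ : ℕ → ℝ) (k : Fin M → ℕ)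
    (x : ℕ → ℕ → ℝ) (y : ℕ → ℝ) (m : Fin M) : ℝ :=
  1 / blockRisk V θ k x m ^ 2 * (noiseTerm V x (fun i : Fin n => y i) (k m) - k m) ^ 2

/-- The fourth power of the relative size of the cross term of a model. -/
noncomputable def crossDev (V : Matrix (Fin n) (Fin n) ℝ) (θ : ℕ → ℝ) (k : Fin M → ℕ)
    (x : ℕ → ℕ → ℝ) (y : ℕ → ℝ) (m : Fin M) : ℝ :=
  1 / modelRisk V x (regMean θ x n) (k m) ^ 4 *
    crossTerm V x (regMean θ x n) (fun i : Fin n => y i) (k m) ^ 4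

/-- The total deviation: cross terms of all models, noise terms of the models in `S₁` and `S₂`. -/
noncomputable def deviation (V : Matrix (Fin n) (Fin n) ℝ) (θ : ℕ → ℝ) (k : Fin M → ℕ)
    (S₁ S₂ : Finset (Fin M)) (x : ℕ → ℕ → ℝ) (y : ℕ → ℝ) : ℝ :=
  ∑ m, crossDev V θ k x y m + (∑ m ∈ S₁, noiseDev V θ k x y m + ∑ m ∈ S₂, noiseDev V θ k x y m)

variable {V : Matrix (Fin n) (Fin n) ℝ} {θ : ℕ → ℝ} {k : Fin M → ℕ} {x : ℕ → ℕ → ℝ} {y : ℕ → ℝ}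
  {S₁ S₂ : Finset (Fin M)}

lemma blockRisk_pos (m : Fin M) : 0 < blockRisk V θ k x m :=
  lt_of_lt_of_le one_pos ((le_max_right _ _).trans (le_max_right _ _))

lemma noiseDev_nonneg (m : Fin M) : 0 ≤ noiseDev V θ k x y m :=
  mul_nonneg (by positivity) (sq_nonneg _)

lemma crossDev_nonneg (m : Fin M) : 0 ≤ crossDev V θ k x y m := by
  rw [crossDev]
  have : ∀ z : ℝ, 0 ≤ z ^ 4 := fun z => by positivity
  exact mul_nonneg (one_div_nonneg.2 (this _)) (this _)

lemma crossDev_le_deviation (m : Fin M) : crossDev V θ k x y m ≤ deviation V θ k S₁ S₂ x y :=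
  (Finset.single_le_sum (fun m _ => crossDev_nonneg m) (Finset.mem_univ m)).trans
    (le_add_of_nonneg_right (add_nonneg (Finset.sum_nonneg fun m _ => noiseDev_nonneg m)
      (Finset.sum_nonneg fun m _ => noiseDev_nonneg m)))

lemma noiseDev_le_deviation_left {m : Fin M} (hm : m ∈ S₁) :
    noiseDev V θ k x y m ≤ deviation V θ k S₁ S₂ x y := by
  have h1 := Finset.single_le_sum (f := noiseDev V θ k x y) (fun m _ => noiseDev_nonneg m) hm
  have h2 : 0 ≤ ∑ m ∈ S₂, noiseDev V θ k x y m := Finset.sum_nonneg fun m _ => noiseDev_nonneg m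
  have h3 : 0 ≤ ∑ m, crossDev V θ k x y m := Finset.sum_nonneg fun m _ => crossDev_nonneg m
  rw [deviation]; linarith

lemma noiseDev_le_deviation_right {m : Fin M} (hm : m ∈ S₂) :
    noiseDev V θ k x y m ≤ deviation V θ k S₁ S₂ x y := by
  have h1 := Finset.single_le_sum (f := noiseDev V θ k x y) (fun m _ => noiseDev_nonneg m) hm
  have h2 : 0 ≤ ∑ m ∈ S₁, noiseDev V θ k x y m := Finset.sum_nonneg fun m _ => noiseDev_nonneg m
  have h3 : 0 ≤ ∑ m, crossDev V θ k x y m := Finset.sum_nonneg fun m _ => crossDev_nonneg m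
  rw [deviation]; linarith

lemma minRisk_le (m : Fin M) : minRisk V θ k x ≤ modelRisk V x (regMean θ x n) (k m) :=
  ciInf_le (Set.finite_range _).bddBelow m

lemma dim_le_modelRisk (hV : V.PosDef) (hX : ∀ m, (design x n (k m)).rank = k m) (m : Fin M) :
    (k m : ℝ) ≤ modelRisk V x (regMean θ x n) (k m) := by
  rw [modelRisk_eq hV]
  exact le_add_of_nonneg_left (biasTerm_nonneg hV x _ (hX m))

lemma max_le_modelRisk (hV : V.PosDef) (hk : ∀ m, 1 ≤ k m)
    (hX : ∀ m, (design x n (k m)).rank = k m) (m : Fin M) :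
    max (k m : ℝ) (max (minRisk V θ k x) 1) ≤ modelRisk V x (regMean θ x n) (k m) := by
  have h := dim_le_modelRisk (θ := θ) hV hX m
  exact max_le h (max_le (minRisk_le m) (le_trans (by exact_mod_cast hk m) h))

lemma sqrt_sq_le (m : Fin M) : (Nat.sqrt (k m) : ℝ) ^ 2 ≤ k m := by
  exact_mod_cast Nat.sqrt_le' (k m)

lemma le_sqrt_sq_add (m : Fin M) :
    (k m : ℝ) ≤ (Nat.sqrt (k m) : ℝ) ^ 2 + 2 * Nat.sqrt (k m) := by
  have h := Nat.lt_succ_sqrt' (k m)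
  have h2 : k m ≤ Nat.sqrt (k m) ^ 2 + 2 * Nat.sqrt (k m) := by
    rw [Nat.succ_eq_add_one] at h
    nlinarith
  exact_mod_cast h2

lemma blockRisk_le_modelRisk (hV : V.PosDef) (hk : ∀ m, 1 ≤ k m)
    (hX : ∀ m, (design x n (k m)).rank = k m) (m : Fin M) :
    blockRisk V θ k x m ≤ modelRisk V x (regMean θ x n) (k m) :=
  (max_le_max_right _ (sqrt_sq_le m)).trans (max_le_modelRisk hV hk hX m)

/-- A small total deviation bounds the cross and noise terms of all models. -/
lemma abs_terms_le_of_deviation_le (hV : V.PosDef) (hk : Monotone k) (hk1 : ∀ m, 1 ≤ k m)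
    (hX : ∀ m, (design x n (k m)).rank = k m)
    (hS₁ : ∀ m, ∃ l ∈ S₁, Nat.sqrt (k l) = Nat.sqrt (k m) ∧ l ≤ m)
    (hS₂ : ∀ m, ∃ l ∈ S₂, Nat.sqrt (k l) = Nat.sqrt (k m) ∧ m ≤ l) {η : ℝ} (hη : 0 < η)
    (hη1 : η ≤ 1) (hdev : deviation V θ k S₁ S₂ x y ≤ η ^ 4)
    (hgrid : gridSum (minRisk V θ k x) ≤ η ^ 2 / 4) (m : Fin M) :
    |crossTerm V x (regMean θ x n) (fun i => y i) (k m)| ≤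
        2 * η * modelRisk V x (regMean θ x n) (k m) ∧
      |noiseTerm V x (fun i => y i) (k m) - k m| ≤
        2 * η * modelRisk V x (regMean θ x n) (k m) := by
  have hD := blockRisk_le_modelRisk (θ := θ) hV hk1 hX m
  have hh := blockRisk_pos (V := V) (θ := θ) (k := k) (x := x) m
  have hηD := mul_le_mul_of_nonneg_left hD hη.le
  have hDpos := hh.trans_le hD
  constructor
  · have h1 := (crossDev_le_deviation (S₁ := S₁) (S₂ := S₂) m).trans hdev
    rw [crossDev, one_div_mul_eq_div, div_le_iff₀ (by positivity), ← mul_pow] at h1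
    have h2 : |crossTerm V x (regMean θ x n) (fun i => y i) (k m)| ^ 4 ≤
        (η * modelRisk V x (regMean θ x n) (k m)) ^ 4 := by
      rwa [Even.pow_abs ⟨2, rfl⟩]
    have h3 := (pow_le_pow_iff_left₀ (abs_nonneg _) (by positivity) (by norm_num)).1 h2
    nlinarith [mul_pos hη hDpos]
  · have hblock : ∀ l, Nat.sqrt (k l) = Nat.sqrt (k m) →
        noiseDev V θ k x y l ≤ deviation V θ k S₁ S₂ x y →
        |noiseTerm V x (fun i => y i) (k l) - k l| ≤ η * blockRisk V θ k x m := by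
      intro l hl hdl
      have h1 := hdl.trans hdev
      have hb : blockRisk V θ k x l = blockRisk V θ k x m := by rw [blockRisk, blockRisk, hl]
      rw [noiseDev, hb, one_div_mul_eq_div, div_le_iff₀ (by positivity)] at h1
      refine abs_le_of_sq_le_sq ?_ (by positivity)
      have h4 : η ^ 4 ≤ η ^ 2 := pow_le_pow_of_le_one hη.le hη1 (by norm_num)
      rw [mul_pow]
      exact h1.trans (mul_le_mul_of_nonneg_right h4 (sq_nonneg _))
    -- With `j` the integer square root and `h` the block risk, `(2 j)² ≤ 4 h ≤ η² h²`: the first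
    -- since `j² ≤ h`, the second since the zeroth grid term gives `4 ≤ η² h`.
    have hgap : 2 * (Nat.sqrt (k m) : ℝ) ≤ η * blockRisk V θ k x m := by
      have h1 := (one_div_le_gridSum _).trans hgrid
      rw [div_le_iff₀ (by positivity)] at h1
      have h2 : max (minRisk V θ k x) 1 ≤ blockRisk V θ k x m := le_max_right _ _
      have h3 : (Nat.sqrt (k m) : ℝ) ^ 2 ≤ blockRisk V θ k x m := le_max_left _ _
      have h4 : (2 * (Nat.sqrt (k m) : ℝ)) ^ 2 ≤ (η * blockRisk V θ k x m) ^ 2 := by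
        have h5 : 4 ≤ η ^ 2 * blockRisk V θ k x m := by
          have := mul_le_mul_of_nonneg_left h2 (sq_nonneg η)
          linarith
        calc (2 * (Nat.sqrt (k m) : ℝ)) ^ 2 = 4 * (Nat.sqrt (k m) : ℝ) ^ 2 := by ring
          _ ≤ 4 * blockRisk V θ k x m := by linarith
          _ ≤ (η ^ 2 * blockRisk V θ k x m) * blockRisk V θ k x m :=
            mul_le_mul_of_nonneg_right h5 hh.le
          _ = _ := by ring
      exact (pow_le_pow_iff_left₀ (by positivity) (by positivity) two_ne_zero).1 h4
    -- The noise term of `m` lies between those of the first and last model of its block. Each of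
    -- these is within `η h` of its dimension, and dimensions within the block differ by at most `2
    -- j ≤ η h`.
    obtain ⟨l₁, hl₁, hf₁, hle₁⟩ := hS₁ m
    obtain ⟨l₂, hl₂, hf₂, hle₂⟩ := hS₂ m
    have b1 := abs_le.1 (hblock l₁ hf₁ (noiseDev_le_deviation_left hl₁))
    have b2 := abs_le.1 (hblock l₂ hf₂ (noiseDev_le_deviation_right hl₂))
    have n1 := noiseTerm_mono hV x (fun i : Fin n => y i) hk hX hle₁
    have n2 := noiseTerm_mono hV x (fun i : Fin n => y i) hk hX hle₂
    have k1 := sqrt_sq_le (k := k) l₁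
    have k2 := le_sqrt_sq_add (k := k) l₂
    have k3 := sqrt_sq_le (k := k) m
    have k4 := le_sqrt_sq_add (k := k) m
    rw [hf₁] at k1
    rw [hf₂] at k2
    rw [abs_le]
    constructor <;> linarith [b1.1, b2.2]

lemma measurable_minRisk (hV : V.PosDef) : Measurable (minRisk V θ k) :=
  Measurable.iInf fun _ => measurable_modelRisk hV θ

lemma measurable_deviation (hV : V.PosDef) :
    Measurable fun p : (ℕ → ℕ → ℝ) × (ℕ → ℝ) => deviation V θ k S₁ S₂ p.1 p.2 := by
  have hn : ∀ m, Measurable fun p : (ℕ → ℕ → ℝ) × (ℕ → ℝ) => noiseDev V θ k p.1 p.2 m := fun m =>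
    (((measurable_const.max (((measurable_minRisk hV).comp measurable_fst).max
      measurable_const)).pow_const 2).const_div 1).mul
        ((measurable_noiseTerm.sub_const _).pow_const 2)
  have hc : ∀ m, Measurable fun p : (ℕ → ℕ → ℝ) × (ℕ → ℝ) => crossDev V θ k p.1 p.2 m := fun m =>
    ((((measurable_modelRisk hV θ).comp measurable_fst).pow_const 4).const_div 1).mul
      ((measurable_crossTerm θ).pow_const 4)
  exact (Finset.measurable_sum _ fun m _ => hc m).add ((Finset.measurable_sum _ fun m _ => hn m).add
    (Finset.measurable_sum _ fun m _ => hn m))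

end Deviation

/-! ### Expected deviation for fixed regressors -/

section Expectation

variable {Ω : Type*} [mΩ : MeasurableSpace Ω] {P : Measure Ω} [IsProbabilityMeasure P]
variable {ℱ : Filtration ℤ mΩ} {α : ℤ → Ω → ℝ} {σ τ : ℝ} {β : ℕ → ℝ} {e : ℤ → Ω → ℝ}
variable {n M : ℕ} {k : Fin M → ℕ} {x : ℕ → ℕ → ℝ} {θ : ℕ → ℝ} {S₁ S₂ : Finset (Fin M)}

/-- The expected deviation, for given regressors. -/
lemma IsHomoscedasticMDS.lintegral_deviation_le (h : IsHomoscedasticMDS P ℱ α σ τ)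
    (hβ : Summable fun k => |β k|) (hσ : σ ≠ 0) (hem : ∀ t, Measurable (e t))
    (he : ∀ t, ∀ᵐ ω ∂P, HasSum (fun k : ℕ => β k * α (t - k) ω) (e t ω))
    (hV : (errCov P e n).PosDef) (hk : StrictMono k) (hk1 : ∀ m, 1 ≤ k m)
    (hX : ∀ m, (design x n (k m)).rank = k m)
    (hS₁ : Set.InjOn (fun m => Nat.sqrt (k m)) S₁) (hS₂ : Set.InjOn (fun m => Nat.sqrt (k m)) S₂) :
    ∫⁻ ω, ENNReal.ofReal (deviation (errCov P e n) θ k S₁ S₂ x fun i => e ((i : ℤ) + 1) ω) ∂P ≤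
      ENNReal.ofReal ((2 * ((2 * τ + 8 * σ ^ 4) / σ ^ 4 + 1) +
        8 * ((2 * τ + 8 * σ ^ 4) / σ ^ 4)) * gridSum (minRisk (errCov P e n) θ k x)) := by
  have hτ := h.tau_nonneg
  set C := (2 * τ + 8 * σ ^ 4) / σ ^ 4 with hC
  have hC0 : 0 ≤ C := by positivity
  set V := errCov P e n with hVdef
  set R := minRisk V θ k x with hR
  have hY : Measurable fun ω (i : ℕ) => e ((i : ℤ) + 1) ω := measurable_pi_lambda _ fun i => hem _
  have hpair : Measurable fun ω => (x, fun i : ℕ => e ((i : ℤ) + 1) ω) :=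
    measurable_const.prodMk hY
  have hcm : ∀ m, Measurable fun ω => crossDev V θ k x (fun i : ℕ => e ((i : ℤ) + 1) ω) m :=
    fun m => ((((measurable_crossTerm θ).comp hpair).pow_const 4).const_mul _)
  have hnm : ∀ m, Measurable fun ω => noiseDev V θ k x (fun i : ℕ => e ((i : ℤ) + 1) ω) m :=
    fun m => (((measurable_noiseTerm.comp hpair).sub_const _).pow_const 2).const_mul _
  have hcross : ∀ m, ∫⁻ ω, ENNReal.ofReal
      (crossDev V θ k x (fun i : ℕ => e ((i : ℤ) + 1) ω) m) ∂P ≤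
      ENNReal.ofReal (2 * (C + 1) * (1 / max ((k m : ℝ) ^ 2) (max R 1))) := by
    intro m
    have hD := max_le_modelRisk (θ := θ) hV hk1 hX m
    set D := modelRisk V x (regMean θ x n) (k m) with hDdef
    have hD1 : 1 ≤ D := ((le_max_right _ _).trans (le_max_right _ _)).trans hD
    have hbD : biasTerm V x (regMean θ x n) (k m) ≤ D := by
      rw [hDdef, modelRisk_eq hV]
      exact le_add_of_nonneg_right (Nat.cast_nonneg _)
    have hb0 := biasTerm_nonneg hV x (regMean θ x n) (hX m)
    refine lintegral_ofReal_mul_le (by positivity)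
      (h.lintegral_crossTerm_le hβ hσ he hV (hX m) (regMean θ x n)) ?_
    rw [← hC, ← hVdef]
    -- Since `b ≤ D`, the fourth moment over `D ^ 4` is of order `1 / D ^ 2`; and `D ^ 2` exceeds
    -- both `k ^ 2` and `max R 1`, because `1 ≤ D`.
    have h1 : biasTerm V x (regMean θ x n) (k m) ^ 2 ≤ D ^ 2 := pow_le_pow_left₀ hb0 hbD 2
    have h2 : max ((k m : ℝ) ^ 2) (max R 1) ≤ D ^ 2 := by
      refine max_le (pow_le_pow_left₀ (Nat.cast_nonneg _) ((le_max_left _ _).trans hD) 2) ?_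
      exact ((le_max_right _ _).trans hD).trans (by nlinarith)
    calc 1 / D ^ 4 * (2 * (C + 1) * biasTerm V x (regMean θ x n) (k m) ^ 2)
        ≤ 1 / D ^ 4 * (2 * (C + 1) * D ^ 2) := by gcongr
      _ = 2 * (C + 1) * (1 / D ^ 2) := by field_simp
      _ ≤ _ := by gcongr
  have hnoise : ∀ m, ∫⁻ ω, ENNReal.ofReal
      (noiseDev V θ k x (fun i : ℕ => e ((i : ℤ) + 1) ω) m) ∂P ≤
      ENNReal.ofReal (4 * C * (1 / max ((Nat.sqrt (k m) : ℝ) ^ 2) (max R 1))) := by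
    intro m
    have hh := blockRisk_pos (V := V) (θ := θ) (k := k) (x := x) m
    refine lintegral_ofReal_mul_le (by positivity)
      (h.lintegral_noiseTerm_le hβ hσ he hV (hX m)) ?_
    rw [← hC]
    change _ ≤ 4 * C * (1 / blockRisk V θ k x m)
    have h1 := le_sqrt_sq_add (k := k) m
    have h2 : (1 : ℝ) ≤ Nat.sqrt (k m) := by
      have : 0 < Nat.sqrt (k m) := Nat.sqrt_pos.2 (hk1 m)
      exact_mod_cast this
    have h3 : (Nat.sqrt (k m) : ℝ) ^ 2 ≤ blockRisk V θ k x m := le_max_left _ _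
    -- As `1 ≤ √k` for the integer root, `k ≤ j² + 2 j ≤ 3 j²`, so one power of the block risk
    -- cancels against the variance.
    have h4 : (k m : ℝ) ≤ 4 * blockRisk V θ k x m := by nlinarith
    calc 1 / blockRisk V θ k x m ^ 2 * (C * k m)
        ≤ 1 / blockRisk V θ k x m ^ 2 * (C * (4 * blockRisk V θ k x m)) := by gcongr
      _ = _ := by field_simp
  have s0 : ∀ ω, 0 ≤ ∑ m, crossDev V θ k x (fun i : ℕ => e ((i : ℤ) + 1) ω) m := fun ω =>
    Finset.sum_nonneg fun m _ => crossDev_nonneg m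
  have s1 : ∀ (S : Finset (Fin M)) ω,
      0 ≤ ∑ m ∈ S, noiseDev V θ k x (fun i : ℕ => e ((i : ℤ) + 1) ω) m := fun S ω =>
    Finset.sum_nonneg fun m _ => noiseDev_nonneg m
  have hsplit : ∀ ω, ENNReal.ofReal (deviation V θ k S₁ S₂ x fun i => e ((i : ℤ) + 1) ω) =
      ENNReal.ofReal (∑ m, crossDev V θ k x (fun i : ℕ => e ((i : ℤ) + 1) ω) m) +
      (ENNReal.ofReal (∑ m ∈ S₁, noiseDev V θ k x (fun i : ℕ => e ((i : ℤ) + 1) ω) m) +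
        ENNReal.ofReal (∑ m ∈ S₂, noiseDev V θ k x (fun i : ℕ => e ((i : ℤ) + 1) ω) m)) := by
    intro ω
    rw [deviation, ENNReal.ofReal_add (s0 ω) (add_nonneg (s1 _ ω) (s1 _ ω)),
      ENNReal.ofReal_add (s1 _ ω) (s1 _ ω)]
  have g0 := gridSum_nonneg R
  have hnS : ∀ S : Finset (Fin M), Set.InjOn (fun m => Nat.sqrt (k m)) S →
      ∫⁻ ω, ENNReal.ofReal (∑ m ∈ S, noiseDev V θ k x (fun i : ℕ => e ((i : ℤ) + 1) ω) m) ∂P ≤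
        ENNReal.ofReal (4 * C * gridSum R) := by
    intro S hS
    refine (lintegral_ofReal_sum_le S (fun m _ => hnm m) (fun m _ ω => noiseDev_nonneg m)
      (fun m _ => by positivity) fun m _ => hnoise m).trans (ENNReal.ofReal_le_ofReal ?_)
    rw [← Finset.mul_sum]
    exact mul_le_mul_of_nonneg_left (sum_le_gridSum S hS R) (by positivity)
  have hcS : ∫⁻ ω, ENNReal.ofReal (∑ m, crossDev V θ k x (fun i : ℕ => e ((i : ℤ) + 1) ω) m) ∂P ≤
      ENNReal.ofReal (2 * (C + 1) * gridSum R) := by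
    refine (lintegral_ofReal_sum_le _ (fun m _ => hcm m) (fun m _ ω => crossDev_nonneg m)
      (fun m _ => by positivity) fun m _ => hcross m).trans (ENNReal.ofReal_le_ofReal ?_)
    rw [← Finset.mul_sum]
    exact mul_le_mul_of_nonneg_left (sum_le_gridSum _ hk.injective.injOn R) (by positivity)
  simp_rw [hsplit]
  rw [lintegral_add_left (Finset.measurable_sum _ fun m _ => hcm m).ennreal_ofReal,
    lintegral_add_left (Finset.measurable_sum _ fun m _ => hnm m).ennreal_ofReal]
  refine (add_le_add hcS (add_le_add (hnS S₁ hS₁) (hnS S₂ hS₂))).trans (le_of_eq ?_)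
  rw [← ENNReal.ofReal_add (by positivity) (by positivity),
    ← ENNReal.ofReal_add (by positivity) (by positivity)]
  congr 1
  ring

end Expectation

end AMMA

/-! ### Convergence in probability of the loss ratio -/

theorem theorem1 {Ω : Type*} [mΩ : MeasurableSpace Ω] (P : Measure Ω) [IsProbabilityMeasure P]
    -- regressors (zero-based: `x i j` is regressor `j + 1` at time `i + 1`) and coefficients
    (x : ℕ → ℕ → Ω → ℝ) (θ : ℕ → ℝ)
    (hx_meas : ∀ i j, Measurable (x i j))
    (hx_mom : ∃ B : ℝ, ∀ i j, MemLp (x i j) 2 P ∧ ∫ ω, (x i j ω) ^ 2 ∂P ≤ B)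
    (hθ : Summable fun j => |θ j|)
    -- errors
    (e : ℤ → Ω → ℝ) (ℱ : Filtration ℤ mΩ) (α : ℤ → Ω → ℝ) (β : ℕ → ℝ) (σ S : ℝ)
    (N : ℕ) (hN : 1 ≤ N) (hS : 4 * (N : ℝ) < S)
    (hA1 : AMMA.IsLinearErrorProcess P e ℱ α β σ S)
    (hA2 : AMMA.HasNonvanishingSpectrum β σ)
    (hindep : IndepFun (fun ω (i : ℕ) => e ((i : ℤ) + 1) ω) (fun ω (i j : ℕ) => x i j ω) P)
    -- candidate models: `1 ≤ k_1 < ⋯ < k_M < n`, full rank design matrices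
    (M : ℕ → ℕ) (k : (n : ℕ) → Fin (M n) → ℕ)
    (hM : ∀ᶠ n in atTop, 1 ≤ M n)
    (hk_mono : ∀ n, StrictMono (k n))
    (hk_bound : ∀ n m, 1 ≤ k n m ∧ k n m < n)
    (hrank : ∀ n m, ∀ᵐ ω ∂P,
      (AMMA.design (fun i j => x i j ω) n (k n m)).rank = k n m)
    -- `k*_n = min_m D_n(m) → ∞` almost surely
    (hD : ∀ᵐ ω ∂P, Tendsto (fun n : ℕ => ⨅ m : Fin (M n),
      AMMA.modelRisk (AMMA.errCov P e n) (fun i j => x i j ω)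
        (AMMA.regMean θ (fun i j => x i j ω) n) (k n m)) atTop atTop)
    -- the weight set and a minimizer of the criterion over it
    (δ : ℝ) (hδ : 0 < δ) (hδN : δ < 1 / (N : ℝ))
    (w : (n : ℕ) → Ω → Fin (M n) → ℝ)
    (hw : ∀ᶠ n in atTop, ∀ᵐ ω ∂P, w n ω ∈ AMMA.weightSet (M n) N δ ∧
      IsMinOn (AMMA.criterion (AMMA.errCov P e n) (fun i j => x i j ω) (k n)
        (AMMA.response θ (fun i j => x i j ω) (fun t => e t ω) n))
        (AMMA.weightSet (M n) N δ) (w n ω)) :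
    TendstoInMeasure P
      (fun (n : ℕ) (ω : Ω) =>
        AMMA.loss (AMMA.errCov P e n) (fun i j => x i j ω) (k n)
            (AMMA.regMean θ (fun i j => x i j ω) n)
            (AMMA.response θ (fun i j => x i j ω) (fun t => e t ω) n) (w n ω) /
          sInf (AMMA.loss (AMMA.errCov P e n) (fun i j => x i j ω) (k n)
            (AMMA.regMean θ (fun i j => x i j ω) n)
            (AMMA.response θ (fun i j => x i j ω) (fun t => e t ω) n) ''
              AMMA.weightSet (M n) N δ))
      atTop (fun _ => (1 : ℝ)) := by
  obtain ⟨τ, hα⟩ := hA1.isHomoscedasticMDS (S := S) (by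
    have : (1 : ℝ) ≤ N := by exact_mod_cast hN
    linarith)
  have hσ := hA2.sigma_ne_zero
  have hV : ∀ n, (AMMA.errCov P e n).PosDef :=
    hα.errCov_posDef hA2.summable hA1.beta_zero hσ hA1.linear
  have hτ := hα.tau_nonneg
  have hS₁ := fun n => AMMA.exists_fibre_minima fun m => Nat.sqrt (k n m)
  -- Minima in the dual order are the largest models of the blocks.
  have hS₂ := fun n => AMMA.exists_fibre_minima (ι := (Fin (M n))ᵒᵈ)
    fun m => Nat.sqrt (k n (OrderDual.ofDual m))
  choose S₁ hS₁inj hS₁ using hS₁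
  choose S₂ hS₂inj hS₂ using hS₂
  set X : Ω → ℕ → ℕ → ℝ := fun ω i j => x i j ω with hX
  set Y : Ω → ℕ → ℝ := fun ω i => e ((i : ℤ) + 1) ω with hY
  have hXm : Measurable X :=
    measurable_pi_lambda _ fun i => measurable_pi_lambda _ fun j => hx_meas i j
  have hYm : Measurable Y := measurable_pi_lambda _ fun i => hA1.measurable _
  set dev : (n : ℕ) → (ℕ → ℕ → ℝ) × (ℕ → ℝ) → ℝ := fun n p =>
    AMMA.deviation (AMMA.errCov P e n) θ (k n) (S₁ n) (S₂ n) p.1 p.2 with hdev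
  have hdevm : ∀ n, Measurable (dev n) := fun n => AMMA.measurable_deviation (hV n)
  set R : ℕ → Ω → ℝ := fun n ω => AMMA.minRisk (AMMA.errCov P e n) θ (k n) (X ω) with hR
  have hgm : ∀ n, Measurable fun ω => AMMA.gridSum (R n ω) := fun n =>
    AMMA.gridSum_antitone.measurable.comp ((AMMA.measurable_minRisk (hV n)).comp hXm)
  have hrank' : ∀ᵐ ω ∂P, ∀ n m, (AMMA.design (X ω) n (k n m)).rank = k n m :=
    ae_all_iff.2 fun n => ae_all_iff.2 fun m => hrank n m
  set C := 2 * ((2 * τ + 8 * σ ^ 4) / σ ^ 4 + 1) + 8 * ((2 * τ + 8 * σ ^ 4) / σ ^ 4) with hC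
  have hC0 : 0 ≤ C := by positivity
  have hdevle : ∀ n, ∫⁻ ω, ENNReal.ofReal (dev n (X ω, Y ω)) ∂P ≤
      ∫⁻ ω, ENNReal.ofReal (C * AMMA.gridSum (R n ω)) ∂P := by
    intro n
    rw [AMMA.lintegral_indep_eq (F := fun p => ENNReal.ofReal (dev n p)) hXm hYm hindep.symm
      (hdevm n).ennreal_ofReal]
    refine lintegral_mono_ae ?_
    filter_upwards [hrank'] with ω hω
    exact hα.lintegral_deviation_le hA2.summable hσ hA1.measurable hA1.linear (hV n) (hk_mono n)
      (fun m => (hk_bound n m).1) (hω n) (hS₁inj n) (hS₂inj n)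
  -- The factor `C + 1` pays for the expected deviation and for `gridSum` itself, since both must be
  -- small at once.
  have hlim : Tendsto (fun n => ∫⁻ ω, ENNReal.ofReal ((C + 1) * AMMA.gridSum (R n ω)) ∂P) atTop
      (𝓝 0) := by
    have h := tendsto_lintegral_of_dominated_convergence (μ := P) (f := fun _ => 0)
      (F := fun n ω => ENNReal.ofReal ((C + 1) * AMMA.gridSum (R n ω)))
      (fun _ => ENNReal.ofReal ((C + 1) * AMMA.gridSum 1))
      (fun n => ((hgm n).const_mul _).ennreal_ofReal) (fun n => ?_) (by simp) ?_
    · simpa using h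
    · refine ae_of_all _ fun ω => ENNReal.ofReal_le_ofReal ?_
      refine mul_le_mul_of_nonneg_left ?_ (by positivity)
      -- The truncation at `1` inside `gridSum` provides a constant majorant whatever the minimal
      -- risk is.
      have hmax : AMMA.gridSum (R n ω) = AMMA.gridSum (max (R n ω) 1) := by
        simp [AMMA.gridSum]
      rw [hmax]
      exact AMMA.gridSum_antitone (le_max_right _ _)
    · filter_upwards [hD] with ω hω
      have h1 : Tendsto (fun n => AMMA.gridSum (R n ω)) atTop (𝓝 0) :=
        AMMA.tendsto_gridSum.comp hω
      have h2 := ENNReal.tendsto_ofReal (h1.const_mul (C + 1))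
      simpa using h2
  have htot : Tendsto (fun n => ∫⁻ ω, (ENNReal.ofReal (dev n (X ω, Y ω)) +
      ENNReal.ofReal (AMMA.gridSum (R n ω))) ∂P) atTop (𝓝 0) := by
    refine tendsto_of_tendsto_of_tendsto_of_le_of_le tendsto_const_nhds hlim
      (fun _ => zero_le) fun n => ?_
    calc ∫⁻ ω, (ENNReal.ofReal (dev n (X ω, Y ω)) + ENNReal.ofReal (AMMA.gridSum (R n ω))) ∂P
        = ∫⁻ ω, ENNReal.ofReal (dev n (X ω, Y ω)) ∂P +
            ∫⁻ ω, ENNReal.ofReal (AMMA.gridSum (R n ω)) ∂P :=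
          lintegral_add_right _ (hgm n).ennreal_ofReal
      _ ≤ ∫⁻ ω, ENNReal.ofReal (C * AMMA.gridSum (R n ω)) ∂P +
            ∫⁻ ω, ENNReal.ofReal (AMMA.gridSum (R n ω)) ∂P :=
          add_le_add (hdevle n) le_rfl
      _ = _ := by
          rw [← lintegral_add_right _ (hgm n).ennreal_ofReal]
          refine lintegral_congr fun ω => ?_
          have := AMMA.gridSum_nonneg (R n ω)
          rw [← ENNReal.ofReal_add (by positivity) this]
          congr 1
          ring
  rw [tendstoInMeasure_iff_norm]
  intro ε hε
  -- The terms are controlled at level `2 * η`. The bound `δ ^ 2 / 32` gives `16 * (2 * η) ≤ δ ^ 2`,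
  -- and `ε * δ ^ 2 / 128` makes the final error `64 * η / δ ^ 2` at most `ε / 2`.
  set η := min 1 (min (δ ^ 2 / 32) (ε * δ ^ 2 / 128)) with hη
  have hη0 : 0 < η := by positivity
  have hη1 : η ≤ 1 := min_le_left _ _
  have hη2 : η ≤ δ ^ 2 / 32 := (min_le_right _ _).trans (min_le_left _ _)
  have hη3 : η ≤ ε * δ ^ 2 / 128 := (min_le_right _ _).trans (min_le_right _ _)
  set c := ENNReal.ofReal (min (η ^ 4) (η ^ 2 / 4)) with hc
  have hc0 : c ≠ 0 := by
    rw [hc, Ne, ENNReal.ofReal_eq_zero, not_le]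
    positivity
  have hmarkov : Tendsto (fun n => (∫⁻ ω, (ENNReal.ofReal (dev n (X ω, Y ω)) +
      ENNReal.ofReal (AMMA.gridSum (R n ω))) ∂P) / c) atTop (𝓝 0) := by
    have := ENNReal.Tendsto.div_const htot (Or.inr hc0)
    simpa using this
  refine tendsto_of_tendsto_of_tendsto_of_le_of_le' tendsto_const_nhds hmarkov
    (Eventually.of_forall fun _ => zero_le) ?_
  filter_upwards [hw] with n hwn
  -- Markov's inequality for deviation plus `gridSum`: off the event that the sum reaches `c`, both
  -- are small and the deterministic comparison contradicts a deviation of the ratio by `ε`.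
  refine le_trans (measure_mono_ae ?_) (meas_ge_le_lintegral_div
    ((((hdevm n).comp (hXm.prodMk hYm)).ennreal_ofReal.add
      (hgm n).ennreal_ofReal)).aemeasurable hc0 ENNReal.ofReal_ne_top)
  filter_upwards [hwn, hrank'] with ω hwω hrω
  intro hω
  by_contra hlt
  change ¬ c ≤ ENNReal.ofReal (dev n (X ω, Y ω)) + ENNReal.ofReal (AMMA.gridSum (R n ω)) at hlt
  rw [not_le] at hlt
  have hmin0 : 0 ≤ min (η ^ 4) (η ^ 2 / 4) := by positivity
  have h1 : dev n (X ω, Y ω) ≤ η ^ 4 :=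
    ((ENNReal.ofReal_le_ofReal_iff hmin0).1 (le_self_add.trans hlt.le)).trans (min_le_left _ _)
  have h2 : AMMA.gridSum (R n ω) ≤ η ^ 2 / 4 :=
    ((ENNReal.ofReal_le_ofReal_iff hmin0).1 (le_add_self.trans hlt.le)).trans (min_le_right _ _)
  have hS₂' : ∀ m, ∃ l ∈ S₂ n, Nat.sqrt (k n l) = Nat.sqrt (k n m) ∧ m ≤ l := fun m => hS₂ n m
  have hterms := AMMA.abs_terms_le_of_deviation_le (hV n) (hk_mono n).monotone
    (fun m => (hk_bound n m).1) (hrω n) (hS₁ n) hS₂' hη0 hη1 h1 h2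
  have hfinal := AMMA.abs_loss_ratio_le (η := 2 * η) (hV n) (X ω) (hk_mono n).monotone
    (fun m => (hk_bound n m).1) (hrω n) (AMMA.regMean θ (X ω) n) (fun i : Fin n => Y ω i) hδ
    (by positivity) (by linarith) (fun m => (hterms m).1) (fun m => (hterms m).2) hwω.1 hwω.2
  have hlt' : 32 * (2 * η) / δ ^ 2 < ε := by
    rw [div_lt_iff₀ (by positivity)]
    nlinarith [mul_pos hε (pow_pos hδ 2)]
  exact absurd (hω.trans hfinal) (not_le.2 hlt')
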